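/- **Setting.** Let $n\ge 1$ and let $\mathbb R_n$ be the real Clifford algebra with generators $e_1,\dots,e_n$, $e_i^2=-1$, $e_ie_j=-e_je_i$ $(i\ne j)$, with basis $e_A=e_{i_1}\cdots e_{i_k}$ for $A=\{i_1<\dots<i_k\}\subseteq\{1,\dots,n\}$, norm $|a|^2=\sum_A a_A^2$, real part $\mathrm{Re}\,a=a_\emptyset$ and conjugation $a\mapsto\bar a$ (the anti-automorphism with $\bar e_i=-e_i$). Identify $\mathbb R^{n+1}$ with the paravectors $a_0+a_1e_1+\dots+a_ne_n$; let $\mathbb S$ be the set of paravectors with $a_0=0$ and $|a|=1$. For $I\in\mathbb S$ put $\mathbb C_I=\{u+Iv:u,v\in\mathbb R\}$ and $\mathbb C_I^+=\{u+Iv: v\ge 0\}$; for $w=u+Iv$ write $\mathrm{Re}\,w=u$, $\mathrm{Im}\,w=v$. Let $H$ be a real Hilbert space and $\mathcal H_n=H\otimes\mathbb R_n=\{\sum_A x_A\otimes e_A\}$, a right $\mathbb R_n$-module with $\|x\|^2=\sum_A\|x_A\|^2$ and $\mathbb R_n$-valued inner product $\langle x,y\rangle=\sum_{A,B}\langle x_A,y_B\rangle\,\bar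 e_B e_A$ (so $\langle xa,y\rangle=\langle x,y\rangle a$, $\langle x,ya\rangle=\bar a\langle x,y\rangle$). Operators are right linear, with domain a right submodule. Adjoints are taken with respect to $\langle\cdot,\cdot\rangle$: $y\in\mathcal D(T^*)$ with $T^*y=z$ iff $\langle Tx,y\rangle=\langle x,z\rangle$ for all $x\in\mathcal D(T)$. $T$ is *normal* if it is densely defined and closed, $\mathcal D(T)=\mathcal D(T^*)$ and $TT^*=T^*T$. $\mathcal B(\mathcal H_n)$ denotes the everywhere defined bounded operators. The *$S$-spectrum* is $\sigma_S(T)=\mathbb R^{n+1}\setminus\rho_S(T)$, where $s\in\rho_S(T)$ iff $Q_s(T)=T^2-2\,\mathrm{Re}(s)\,T+|s|^2$, with domain $\mathcal D(T^2)$, has trivial kernel, dense range and bounded inverse $\mathrm{Ran}\,Q_s(T)\to\mathcal D(T^2)$ (for the norm of $\mathcal H_n$). It is a closed axially symmetric set. Fix $I\in\mathbb S$ and put $\Omega_I^+=\sigma_S(T)\cap\mathbb C_I^+$. A *spectral measure* $E$ on the Borel sets of $\Omega_I^+$ assigns to each Borel set an orthogonal (self-adjoint, idempotent) projection $E(M)\in\mathcal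 B(\mathcal H_n)$, is countably additive in the strong operator topology, and satisfies $E(\Omega_I^+)=\mathrm{id}$. Let $J\in\mathcal B(\mathcal H_n)$ be a partial imaginary operator ($J$ is a partial isometry and $J^*=-J$) that commutes with all $E(M)$ and satisfies $J^2=-\mathrm{id}$ on the range of $E(\{\lambda:\mathrm{Im}\,\lambda>0\})$; every imaginary operator ($J^*=-J$, $J$ unitary) commuting with $E$ is such a $J$. For a bounded Borel function $f:\Omega_I^+\to\mathbb C_I$ let $$\mathbb I(f)=\int \mathrm{Re} f\,dE+\Big(\int \mathrm{Im} f\,dE\Big)J\in\mathcal B(\mathcal H_n),$$ where the integral of a simple function $\sum_j c_j\chi_{M_j}$ (with $c_j\in\mathbb R$ and the $M_j$ disjoint) is $\sum_j c_jE(M_j)$ and the integral of a bounded real Borel function is the operator-norm limit of the integrals of uniformly approximating simple functions. $E$ (together with $J$) is *the spectral measure of $T$* if $T=\mathbb I(\lambda)$, i.e. $\mathcal D(T)=\{x:\int|\lambda|^2\,d\,\mathrm{Re}\langle E(\lambda)x,x\rangle<\infty\}$ and $Tx=\lim_{k\to\infty}\mathbb I(\lambda\chi_{\{|\lambda|\le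 k\}})x$ for $x\in\mathcal D(T)$. A function $f$ on $\sigma_S(T)$ is *intrinsic* if there are real-valued $f_0,f_1$ on $\mathcal U=\{(u,v)\in\mathbb R^2:u+\mathbb Sv\subseteq\sigma_S(T)\}$ with $f_0(u,-v)=f_0(u,v)$, $f_1(u,-v)=-f_1(u,v)$ and $f(u+Kv)=f_0(u,v)+Kf_1(u,v)$ for all $(u,v)\in\mathcal U$ and $K\in\mathbb S$. **Theorem (spectral mapping theorem for an unbounded normal operator).** Let $T$ be a (possibly unbounded) normal operator on $\mathcal H_n$, let $I\in\mathbb S$, and let $E$ on $\Omega_I^+=\sigma_S(T)\cap\mathbb C_I^+$, together with $J$, be the spectral measure of $T$. Let $f$ be an intrinsic function on $\sigma_S(T)$ whose restriction to $\Omega_I^+$ is continuous and bounded. Then $$\sigma_S(\mathbb I(f))\cap\mathbb C_I=\overline{f(\sigma_S(T)\cap\mathbb C_I)}.$$ If moreover $T\in\mathcal B(\mathcal H_n)$, then $$\sigma_S(\mathbb I(f))\cap\mathbb C_I=f(\sigma_S(T)\cap\mathbb C_I).$$ -/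

import Mathlib

open MeasureTheory Filter Topology
open scoped symmDiff ENNReal

namespace Clif

/-! ### The real Clifford algebra with `n` anticommuting imaginary units

An element `a = ∑_A a_A e_A` is its family of real coordinates, indexed by the subsets `A` of the
index set; the norm is `|a|² = ∑_A a_A²`.  The basis elements `e_A = e_{i₁} ⋯ e_{iₖ}`
(for `A = {i₁ < ⋯ < iₖ}`) multiply by `e_A e_B = sgn A B e_{A ∆ B}`, the sign being the one that
`e_i e_j = - e_j e_i` (for `i ≠ j`) and `e_i² = -1` produce. -/

/-- The real Clifford algebra `ℝ_n`. -/
abbrev Cl (n : ℕ) : Type := EuclideanSpace ℝ (Finset (Fin n))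

/-- The sign in `e_A e_B = sgn A B e_{A ∆ B}`: sorting the word `e_A e_B` costs a factor `-1` for
every pair `j < i` with `i ∈ A` and `j ∈ B`, and every `i ∈ A ∩ B` contributes `e_i² = -1`. -/
noncomputable def sgn {n : ℕ} (A B : Finset (Fin n)) : ℝ :=
  ∏ i ∈ A, ∏ j ∈ B, if j ≤ i then -1 else 1

theorem prod_symmDiff {ι : Type*} [DecidableEq ι] (t : ι → ℝ) (ht : ∀ i, t i * t i = 1)
    (A B : Finset ι) : ∏ i ∈ A ∆ B, t i = (∏ i ∈ A, t i) * ∏ i ∈ B, t i := by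
  have h1 : ∏ i ∈ A ∩ B, t i * t i = 1 := Finset.prod_eq_one fun i _ => ht i
  rw [Finset.prod_mul_distrib] at h1
  have hd : Disjoint (A \ B) (B \ A) := disjoint_sdiff_sdiff
  have h2 : A ∆ B = (A \ B) ∪ (B \ A) := rfl
  rw [h2, Finset.prod_union hd, ← Finset.prod_inter_mul_prod_sdiff A B t,
    ← Finset.prod_inter_mul_prod_sdiff B A t, Finset.inter_comm B A]
  linear_combination (-(∏ i ∈ A \ B, t i) * ∏ i ∈ B \ A, t i) * h1

theorem sgn_mul_self {n : ℕ} (A B : Finset (Fin n)) : sgn A B * sgn A B = 1 := by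
  unfold sgn
  rw [← Finset.prod_mul_distrib]
  refine Finset.prod_eq_one fun i _ => ?_
  rw [← Finset.prod_mul_distrib]
  exact Finset.prod_eq_one fun j _ => by split_ifs <;> norm_num

theorem sgn_symmDiff_left {n : ℕ} (A B C : Finset (Fin n)) :
    sgn (A ∆ B) C = sgn A C * sgn B C := by
  refine prod_symmDiff _ (fun i => ?_) A B
  rw [← Finset.prod_mul_distrib]
  exact Finset.prod_eq_one fun j _ => by split_ifs <;> norm_num

theorem sgn_symmDiff_right {n : ℕ} (A B C : Finset (Fin n)) :
    sgn A (B ∆ C) = sgn A B * sgn A C := by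
  unfold sgn
  rw [← Finset.prod_mul_distrib]
  refine Finset.prod_congr rfl fun i _ => prod_symmDiff _ (fun j => ?_) B C
  split_ifs <;> norm_num

/-- The basis element `e_A`. -/
noncomputable def e {n : ℕ} (A : Finset (Fin n)) : Cl n := EuclideanSpace.single A 1

noncomputable instance instMulCl {n : ℕ} : Mul (Cl n) :=
  ⟨fun a b => WithLp.toLp 2 fun C => ∑ A, sgn A (A ∆ C) * (a A * b (A ∆ C))⟩

theorem mul_apply {n : ℕ} (a b : Cl n) (C : Finset (Fin n)) :
    (a * b) C = ∑ A, sgn A (A ∆ C) * (a A * b (A ∆ C)) := rfl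

noncomputable instance instOneCl {n : ℕ} : One (Cl n) := ⟨e ∅⟩

theorem one_def {n : ℕ} : (1 : Cl n) = e ∅ := rfl

theorem e_apply {n : ℕ} (A B : Finset (Fin n)) : (e A : Cl n) B = if B = A then 1 else 0 := by
  simp [e]

noncomputable instance instRingCl {n : ℕ} : Ring (Cl n) :=
  { (inferInstance : AddCommGroup (Cl n)) with
    mul := (· * ·)
    one := 1
    left_distrib := fun a b c => by
      ext C; simp [mul_apply, mul_add, Finset.sum_add_distrib]
    right_distrib := fun a b c => by
      ext C; simp [mul_apply, add_mul, mul_add, Finset.sum_add_distrib]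
    zero_mul := fun a => by ext C; simp [mul_apply]
    mul_zero := fun a => by ext C; simp [mul_apply]
    one_mul := fun a => by
      ext C
      have h : (∅ : Finset (Fin n)) ∆ C = C := bot_symmDiff C
      simp [mul_apply, one_def, e_apply, sgn, h]
    mul_one := fun a => by
      ext C
      simp only [mul_apply, one_def, e_apply, ← Finset.bot_eq_empty, symmDiff_eq_bot]
      simp [sgn]
    mul_assoc := fun a b c => by
      ext C
      simp only [mul_apply, Finset.mul_sum, Finset.sum_mul]
      rw [Finset.sum_comm]
      refine Finset.sum_congr rfl fun A _ => ?_
      refine Fintype.sum_equiv (Equiv.ofBijective (fun B => A ∆ B)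
        (symmDiff_right_involutive A).bijective) _ _ fun B => ?_
      have h1 : A ∆ B ∆ (A ∆ C) = B ∆ C := by
        rw [symmDiff_comm A B, symmDiff_assoc, symmDiff_symmDiff_cancel_left]
      simp only [Equiv.ofBijective_apply, h1]
      rw [show B ∆ C = (A ∆ B) ∆ (A ∆ C) from h1.symm]
      simp only [sgn_symmDiff_left, sgn_symmDiff_right]
      have := sgn_mul_self A A
      have := sgn_mul_self A C
      have := sgn_mul_self B A
      have := sgn_mul_self A B
      grind }

/-- Clifford conjugation, the anti-automorphism with `e_i ↦ -e_i`.  As `conj e_A * e_A = 1` and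
`e_A * e_A = sgn A A`, it multiplies the coordinate at `A` by `sgn A A`. -/
noncomputable def conj {n : ℕ} (a : Cl n) : Cl n := WithLp.toLp 2 fun A => sgn A A * a A

/-- The paravectors `a₀ + a₁ e₁ + ⋯ + aₙ eₙ`, i.e. the copy of `ℝ^{n+1}` in `ℝ_n`. -/
def paravectors (n : ℕ) : Set (Cl n) := {a | ∀ A : Finset (Fin n), 1 < A.card → a A = 0}

/-- The sphere `𝕊` of the imaginary units: paravectors with real part `0` and norm `1`. -/
def unitSphere (n : ℕ) : Set (Cl n) := {a | a ∈ paravectors n ∧ a ∅ = 0 ∧ ‖a‖ = 1}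

/-- The plane `ℂ_I = {u + I v : u, v ∈ ℝ}`. -/
def slice {n : ℕ} (I : Cl n) : Set (Cl n) := {a | ∃ u v : ℝ, a = u • 1 + v • I}

/-- The closed half plane `ℂ_I⁺ = {u + I v : u, v ∈ ℝ, 0 ≤ v}`. -/
def upperSlice {n : ℕ} (I : Cl n) : Set (Cl n) := {a | ∃ u v : ℝ, 0 ≤ v ∧ a = u • 1 + v • I}

/-! ### Clifford modules -/

/-- `H_n = H ⊗ ℝ_n`: a vector `x = ∑_A x_A ⊗ e_A` is its family of coordinates `x_A ∈ H`, and
`‖x‖² = ∑_A ‖x_A‖²`. -/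
abbrev CliffordModule (H : Type*) (n : ℕ) : Type _ := PiLp 2 fun _ : Finset (Fin n) => H

section Module

variable {H : Type*} [NormedAddCommGroup H] [InnerProductSpace ℝ H] {n : ℕ}

/-- Right multiplication `x a = ∑_{A, B} a_B x_A ⊗ e_A e_B`. -/
noncomputable def rmul (x : CliffordModule H n) (a : Cl n) : CliffordModule H n :=
  WithLp.toLp 2 fun C => ∑ A, (sgn A (A ∆ C) * a (A ∆ C)) • x A

/-- The Clifford-valued inner product `⟨x, y⟩ = ∑_{A, B} ⟨x_A, y_B⟩ conj(e_B) e_A`; it satisfies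
`⟨x a, y⟩ = ⟨x, y⟩ a` and `⟨x, y a⟩ = conj(a) ⟨x, y⟩`. -/
noncomputable def cliffInner (x y : CliffordModule H n) : Cl n :=
  ∑ A, ∑ B, (inner ℝ (x A) (y B) : ℝ) • (conj (e B) * e A)

theorem conj_e_mul_e_apply_empty (A B : Finset (Fin n)) :
    (conj (e B) * e A : Cl n) ∅ = if A = B then 1 else 0 := by
  have h : ∀ C : Finset (Fin n), C ∆ ∅ = C := fun C => symmDiff_bot C
  simp only [mul_apply, h, conj, e_apply]
  rw [Finset.sum_eq_single B]
  · by_cases hAB : A = B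
    · subst hAB
      simp [sgn_mul_self]
    · simp [hAB, Ne.symm hAB]
  · intro C _ hC
    simp [hC]
  · simp

/-- The real part of the Clifford-valued inner product is the real inner product. -/
theorem cliffInner_apply_empty (x y : CliffordModule H n) :
    cliffInner x y ∅ = inner ℝ x y := by
  have h : cliffInner x y ∅ =
      ∑ A, ∑ B, (inner ℝ (x A) (y B) : ℝ) * (conj (e B) * e A : Cl n) ∅ := by
    simp [cliffInner]
  rw [h, PiLp.inner_apply]
  refine Finset.sum_congr rfl fun A _ => ?_
  simp [conj_e_mul_e_apply_empty]

/-! ### Unbounded right linear operators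

An operator is a partially defined real linear map; `IsRightLinear` says that its domain is a right
submodule and that it commutes with right multiplication. -/

/-- Right linearity of an everywhere defined operator. -/
def IsRightLinearCLM (T : CliffordModule H n →L[ℝ] CliffordModule H n) : Prop :=
  ∀ (x : CliffordModule H n) (a : Cl n), T (rmul x a) = rmul (T x) a

/-- The domain is a right submodule and `T (x a) = (T x) a`. -/
def IsRightLinear (T : CliffordModule H n →ₗ.[ℝ] CliffordModule H n) : Prop :=
  ∀ (x : T.domain) (a : Cl n), ∃ h : rmul (x : CliffordModule H n) a ∈ T.domain,
    T ⟨rmul (x : CliffordModule H n) a, h⟩ = rmul (T x) a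

/-- The graph of the adjoint `T*` (of a densely defined `T`): the pairs `(y, z)` with
`⟨T x, y⟩ = ⟨x, z⟩` for all `x` in the domain of `T`. -/
def adjointRel (T : CliffordModule H n →ₗ.[ℝ] CliffordModule H n) :
    Set (CliffordModule H n × CliffordModule H n) :=
  {p | ∀ x : T.domain, cliffInner (T x) p.1 = cliffInner (x : CliffordModule H n) p.2}

/-- The graph of the product `S R`, from the graphs of `S` and `R`; a vector is in the domain of
the product if it is in the domain of `R` and its image is in the domain of `S`. -/
def relComp (S R : Set (CliffordModule H n × CliffordModule H n)) :
    Set (CliffordModule H n × CliffordModule H n) :=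
  {p | ∃ z, (p.1, z) ∈ R ∧ (z, p.2) ∈ S}

/-- `T` is normal: densely defined, closed, `dom T = dom T*` and `T T* = T* T`
(with equal domains of the two products). -/
def IsNormal (T : CliffordModule H n →ₗ.[ℝ] CliffordModule H n) : Prop :=
  Dense (T.domain : Set (CliffordModule H n)) ∧ T.IsClosed ∧
    (T.domain : Set (CliffordModule H n)) = {y | ∃ z, (y, z) ∈ adjointRel T} ∧
    relComp (T.graph : Set _) (adjointRel T) = relComp (adjointRel T) (T.graph : Set _)

/-- `T` is everywhere defined and bounded. -/
def IsBounded (T : CliffordModule H n →ₗ.[ℝ] CliffordModule H n) : Prop :=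
  T.domain = ⊤ ∧ ∃ C : ℝ, ∀ x : T.domain, ‖T x‖ ≤ C * ‖x‖

/-- The domain of `T²`. -/
abbrev sqDomain (T : CliffordModule H n →ₗ.[ℝ] CliffordModule H n) : Type _ :=
  {x : T.domain // T x ∈ T.domain}

/-- The operator `Q_s(T) = T² - 2 Re(s) T + |s|²` on the domain of `T²`. -/
noncomputable def Q (T : CliffordModule H n →ₗ.[ℝ] CliffordModule H n) (s : Cl n)
    (x : sqDomain T) : CliffordModule H n :=
  T ⟨T x.1, x.2⟩ - (2 * s ∅) • T x.1 + (‖s‖ ^ 2) • (x.1 : CliffordModule H n)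

/-- The `S`-resolvent set: the paravectors `s` for which `Q_s(T)` has trivial kernel, dense range,
and an inverse, from its range to the domain of `T²`, that is bounded. -/
def sResolventSet (T : CliffordModule H n →ₗ.[ℝ] CliffordModule H n) : Set (Cl n) :=
  {s | s ∈ paravectors n ∧
    (∀ x : sqDomain T, Q T s x = 0 → (x.1 : CliffordModule H n) = 0) ∧
    DenseRange (Q T s) ∧
    ∃ C : ℝ, ∀ x : sqDomain T, ‖(x.1 : CliffordModule H n)‖ ≤ C * ‖Q T s x‖}

/-- The `S`-spectrum, a set of paravectors. -/
def sSpectrum (T : CliffordModule H n →ₗ.[ℝ] CliffordModule H n) : Set (Cl n) :=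
  paravectors n \ sResolventSet T

/-- An everywhere defined bounded operator as an operator with domain. -/
def toOp (T : CliffordModule H n →L[ℝ] CliffordModule H n) :
    CliffordModule H n →ₗ.[ℝ] CliffordModule H n :=
  (T : CliffordModule H n →ₗ[ℝ] CliffordModule H n).toPMap ⊤

end Module

/-! ### Spectral measures and spectral integrals -/

/-- A spectral measure on the measurable space `X`: the values on measurable sets are orthogonal
projections that are right linear, the whole space has the value `1`, and the set function is
countably additive in the strong operator topology. -/
structure SpectralMeasure (X : Type*) [MeasurableSpace X] (H : Type*) [NormedAddCommGroup H]
    [InnerProductSpace ℝ H] (n : ℕ) where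
  /-- The underlying set function; only its values on measurable sets matter. -/
  toFun : Set X → (CliffordModule H n →L[ℝ] CliffordModule H n)
  rightLinear : ∀ M, MeasurableSet M → IsRightLinearCLM (toFun M)
  selfAdjoint : ∀ M, MeasurableSet M → ∀ x y : CliffordModule H n,
    cliffInner (toFun M x) y = cliffInner x (toFun M y)
  idempotent : ∀ M, MeasurableSet M → toFun M ∘L toFun M = toFun M
  univ_eq : toFun Set.univ = ContinuousLinearMap.id ℝ (CliffordModule H n)
  hasSum_iUnion : ∀ M : ℕ → Set X, (∀ i, MeasurableSet (M i)) → Pairwise (Function.onFun Disjoint M) →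
    ∀ x : CliffordModule H n, HasSum (fun i => toFun (M i) x) (toFun (⋃ i, M i) x)

namespace SpectralMeasure

variable {X : Type*} [MeasurableSpace X] {H : Type*} [NormedAddCommGroup H]
  [InnerProductSpace ℝ H] {n : ℕ}

theorem toFun_empty (E : SpectralMeasure X H n) (x : CliffordModule H n) : E.toFun ∅ x = 0 := by
  have h := E.hasSum_iUnion (fun _ => ∅) (fun _ => MeasurableSet.empty)
    (fun _ _ _ => disjoint_bot_left) x
  exact tendsto_nhds_unique tendsto_const_nhds h.summable.tendsto_atTop_zero

theorem re_cliffInner_nonneg (E : SpectralMeasure X H n) (x : CliffordModule H n) {M : Set X}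
    (hM : MeasurableSet M) : 0 ≤ cliffInner (E.toFun M x) x ∅ := by
  have h1 : E.toFun M (E.toFun M x) = E.toFun M x := by
    conv_rhs => rw [← E.idempotent M hM]
    rfl
  rw [← h1, E.selfAdjoint M hM, cliffInner_apply_empty]
  exact real_inner_self_nonneg

/-- The finite measure `M ↦ Re ⟨E(M) x, x⟩`. -/
noncomputable def scalarMeasure (E : SpectralMeasure X H n) (x : CliffordModule H n) : Measure X :=
  Measure.ofMeasurable (fun M _ => ENNReal.ofReal (cliffInner (E.toFun M x) x ∅))
    (by rw [E.toFun_empty, cliffInner_apply_empty, inner_zero_left, ENNReal.ofReal_zero])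
    (by
      intro M hM hd
      have h := (E.hasSum_iUnion M hM hd x).mapL (innerSL ℝ x)
      have h2 : HasSum (fun i => cliffInner (E.toFun (M i) x) x ∅)
          (cliffInner (E.toFun (⋃ i, M i) x) x ∅) := by
        simpa [cliffInner_apply_empty, real_inner_comm] using h
      rw [← h2.tsum_eq]
      exact ENNReal.ofReal_tsum_of_nonneg (fun i => E.re_cliffInner_nonneg x (hM i)) h2.summable)

/-- `∫ φ dE = ∑_c c E(φ = c)` for a real simple function `φ`. -/
noncomputable def integralSimple (E : SpectralMeasure X H n) (φ : SimpleFunc X ℝ) :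
    CliffordModule H n →L[ℝ] CliffordModule H n :=
  ∑ c ∈ φ.range, c • E.toFun (φ ⁻¹' {c})

/-- The filter of the real simple functions that approach `g` uniformly. -/
def uniformApprox (g : X → ℝ) : Filter (SimpleFunc X ℝ) :=
  ⨅ (ε : ℝ) (_ : 0 < ε), 𝓟 {φ | ∀ t, |φ t - g t| ≤ ε}

/-- `∫ g dE` for a bounded measurable real function `g`: the limit in operator norm of the
integrals of simple functions that approach `g` uniformly. -/
noncomputable def integral (E : SpectralMeasure X H n) (g : X → ℝ) :
    CliffordModule H n →L[ℝ] CliffordModule H n :=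
  limUnder (uniformApprox g) E.integralSimple

/-- The spectral integral `𝕀(f) = ∫ Re f dE + (∫ Im f dE) J` of a bounded measurable function `f`
with values in the plane `ℂ_I`; for `w = u + I v` in that plane, `u` is the coordinate `w_∅` and
`v` is the real inner product of `I` and `w`. -/
noncomputable def integralJ (E : SpectralMeasure X H n)
    (J : CliffordModule H n →L[ℝ] CliffordModule H n) (I : Cl n) (f : X → Cl n) :
    CliffordModule H n →L[ℝ] CliffordModule H n :=
  E.integral (fun t => f t ∅) + E.integral (fun t => inner ℝ I (f t)) ∘L J

/-- `T = 𝕀(f)` for a measurable, possibly unbounded, function `f` with values in `ℂ_I`: the domain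
of `T` is the set of all `x` with `∫ |f|² d Re⟨E x, x⟩ < ∞`, and for those `x` one has
`T x = lim_k 𝕀(f χ_{|f| ≤ k}) x`. -/
def IsUnboundedIntegral (E : SpectralMeasure X H n)
    (J : CliffordModule H n →L[ℝ] CliffordModule H n) (I : Cl n) (f : X → Cl n)
    (T : CliffordModule H n →ₗ.[ℝ] CliffordModule H n) : Prop :=
  (T.domain : Set (CliffordModule H n)) = {x | ∫⁻ t, ‖f t‖ₑ ^ 2 ∂(E.scalarMeasure x) < ∞} ∧
  ∀ x : T.domain, Tendsto
    (fun k : ℕ => E.integralJ J I ({t | ‖f t‖ ≤ k}.indicator f) (x : CliffordModule H n))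
    atTop (𝓝 (T x))

end SpectralMeasure

section SpectralTheorem

variable {H : Type*} [NormedAddCommGroup H] [InnerProductSpace ℝ H] {n : ℕ}

/-- A partial imaginary operator: a bounded right linear partial isometry `J` with `J* = -J`.
Since `J* = -J`, being a partial isometry (`J J* J = J`) reads `J³ = -J`.  The imaginary operators
(`J* = -J`, `J` unitary) are the case `J² = -1`. -/
def IsPartialImaginary (J : CliffordModule H n →L[ℝ] CliffordModule H n) : Prop :=
  IsRightLinearCLM J ∧
  (∀ x y : CliffordModule H n, cliffInner (J x) y = cliffInner x (-(J y))) ∧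
  J ∘L J ∘L J = -J

/-- `E`, a spectral measure on the Borel sets of `σ_S(T) ∩ ℂ_I⁺`, is the spectral measure of `T`,
and `J` is associated with it: `J` is a partial imaginary operator that commutes with `E`, is
isometric on the range of `E({λ : 0 < Im λ})`, and `T = 𝕀(λ) = ∫ Re λ dE + ∫ Im λ dE J`. -/
def IsSpectralMeasureOf (T : CliffordModule H n →ₗ.[ℝ] CliffordModule H n) (I : Cl n)
    (E : SpectralMeasure ↥(sSpectrum T ∩ upperSlice I) H n)
    (J : CliffordModule H n →L[ℝ] CliffordModule H n) : Prop :=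
  IsPartialImaginary J ∧
  (∀ M, MeasurableSet M → J ∘L E.toFun M = E.toFun M ∘L J) ∧
  J ∘L J ∘L E.toFun {t | 0 < (inner ℝ I (t : Cl n) : ℝ)} =
    -E.toFun {t | 0 < (inner ℝ I (t : Cl n) : ℝ)} ∧
  E.IsUnboundedIntegral J I (fun t => (t : Cl n)) T

end SpectralTheorem

/-- `f` is an intrinsic function on the (axially symmetric) set `Ω` of paravectors: with
`𝒰 = {(u, v) : u + J v ∈ Ω for all J ∈ 𝕊}`, one has `f(u + J v) = f₀(u, v) + J f₁(u, v)` for all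
`(u, v) ∈ 𝒰` and `J ∈ 𝕊`, where `f₀` and `f₁` are real-valued, `f₀` is even in `v` and `f₁` is odd
in `v`. -/
def IsIntrinsicOn {n : ℕ} (f : Cl n → Cl n) (Ω : Set (Cl n)) : Prop :=
  ∃ f₀ f₁ : ℝ → ℝ → ℝ, ∀ u v : ℝ, (∀ J ∈ unitSphere n, u • 1 + v • J ∈ Ω) →
    f₀ u (-v) = f₀ u v ∧ f₁ u (-v) = -f₁ u v ∧
    ∀ J ∈ unitSphere n, f (u • 1 + v • J) = f₀ u v • 1 + f₁ u v • J

end Clif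

namespace Clif

/-! ### The spectral integral of bounded real functions -/

/-! The `S`-spectrum of an operator sees only its real-linear structure, so the real part of the
Clifford inner product turns `E` into a projection-valued measure on a real Hilbert space. On the
range of `E({Im λ > 0})` the operator `J` acts as a multiplication by `i`, and elsewhere only real
functions are integrated. Hence `F ↦ ∫ Re F dE + (∫ Im F dE) J` is multiplicative on bounded complex
functions that are real off `{Im λ > 0}` (`complexIntegral_mul`).

For an operator `∫ l dE`, possibly unbounded, `Q_s` then has the symbol `l² - 2 Re(s) l + |s|² = (l
- s)(l - s̄)`. Truncating to `|l| ≤ k`, where everything is bounded, shows that `Q_s` has a bounded,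
densely defined inverse exactly when this symbol is bounded away from `0` almost everywhere for `E`.
So `s` is in the `S`-spectrum iff `E` does not vanish on any of the sets `{|(l - s)(l - s̄)| < c}`,
`c > 0` (`mem_sSpectrum_iff`).

This criterion is used twice. With `l = λ` and `s` itself in the upper half plane, `|λ - s| ≤ |λ -
s̄|` puts such a set inside a small ball around `s`; since `E` lives on the spectrum, every nonempty
relatively open set has nonzero measure (`toFun_ne_zero`). With `l = f`, continuity of `f` and this
full support replace "almost everywhere" by "everywhere": `s` is in the spectrum of `𝕀(f)` iff `(f -
s)(f - s̄)` comes arbitrarily close to `0`. As `f` intertwines the conjugation of `ℂ_I`, this says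
that `s` is a limit of values of `f` on the whole slice of the spectrum.

If `T` is bounded, then `λ` is essentially bounded, and full support makes the spectrum bounded. It
is closed in the slice by the theorem for the identity function. So the upper half is compact, and
so are its image under `f` and the conjugate of that image. -/

/-- A bounded measurable real function. -/
def IsBddMeasurable {X : Type*} [MeasurableSpace X] (g : X → ℝ) : Prop :=
  Measurable g ∧ ∃ C, ∀ t, |g t| ≤ C

namespace IsBddMeasurable

variable {X : Type*} [MeasurableSpace X] {g h : X → ℝ}

theorem const (c : ℝ) : IsBddMeasurable fun _ : X => c := ⟨measurable_const, |c|, fun _ => le_rfl⟩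

theorem add (hg : IsBddMeasurable g) (hh : IsBddMeasurable h) :
    IsBddMeasurable fun t => g t + h t := by
  obtain ⟨mg, C, hC⟩ := hg
  obtain ⟨mh, D, hD⟩ := hh
  exact ⟨mg.add mh, C + D, fun t => (abs_add_le _ _).trans (add_le_add (hC t) (hD t))⟩

theorem mul (hg : IsBddMeasurable g) (hh : IsBddMeasurable h) :
    IsBddMeasurable fun t => g t * h t := by
  obtain ⟨mg, C, hC⟩ := hg
  obtain ⟨mh, D, hD⟩ := hh
  refine ⟨mg.mul mh, C * D, fun t => ?_⟩
  rw [abs_mul]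
  exact mul_le_mul (hC t) (hD t) (abs_nonneg _) ((abs_nonneg _).trans (hC t))

theorem indicator (hg : IsBddMeasurable g) {M : Set X} (hM : MeasurableSet M) :
    IsBddMeasurable (M.indicator g) := by
  obtain ⟨mg, C, hC⟩ := hg
  refine ⟨mg.indicator hM, C, fun t => ?_⟩
  by_cases ht : t ∈ M
  · simpa [ht] using hC t
  · simpa [ht] using (abs_nonneg _).trans (hC t)

end IsBddMeasurable

/-! ### Projection-valued measures on a real inner product space -/

/-- A projection-valued measure on `X`, with values in the operators of a real inner product
space. -/
structure ProjectionMeasure (X : Type*) [MeasurableSpace X] (V : Type*) [NormedAddCommGroup V]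
    [InnerProductSpace ℝ V] where
  /-- The underlying set function; only its values on measurable sets matter. -/
  toFun : Set X → (V →L[ℝ] V)
  inner_toFun_left : ∀ M, MeasurableSet M → ∀ x y : V,
    inner ℝ (toFun M x) y = inner ℝ x (toFun M y)
  idempotent : ∀ M, MeasurableSet M → toFun M ∘L toFun M = toFun M
  univ_eq : toFun Set.univ = ContinuousLinearMap.id ℝ V
  hasSum_iUnion : ∀ M : ℕ → Set X, (∀ i, MeasurableSet (M i)) →
    Pairwise (Function.onFun Disjoint M) →
    ∀ x : V, HasSum (fun i => toFun (M i) x) (toFun (⋃ i, M i) x)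

open SpectralMeasure (uniformApprox)

namespace ProjectionMeasure

variable {X : Type*} [MeasurableSpace X] {V : Type*} [NormedAddCommGroup V]
  [InnerProductSpace ℝ V]

theorem inner_toFun_self_nonneg (E : ProjectionMeasure X V) {M : Set X} (hM : MeasurableSet M)
    (x : V) : 0 ≤ inner ℝ (E.toFun M x) x := by
  have h1 : E.toFun M (E.toFun M x) = E.toFun M x := by
    conv_rhs => rw [← E.idempotent M hM]
    rfl
  rw [← h1, E.inner_toFun_left M hM]
  exact real_inner_self_nonneg

theorem toFun_empty (E : ProjectionMeasure X V) (x : V) : E.toFun ∅ x = 0 := by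
  have h := E.hasSum_iUnion (fun _ => ∅) (fun _ => MeasurableSet.empty)
    (fun _ _ _ => disjoint_bot_left) x
  exact tendsto_nhds_unique tendsto_const_nhds h.summable.tendsto_atTop_zero

theorem toFun_empty_eq (E : ProjectionMeasure X V) : E.toFun ∅ = 0 := by
  ext1 x
  exact E.toFun_empty x

theorem toFun_union (E : ProjectionMeasure X V) {M N : Set X} (hM : MeasurableSet M)
    (hN : MeasurableSet N) (hMN : Disjoint M N) :
    E.toFun (M ∪ N) = E.toFun M + E.toFun N := by
  ext1 x
  let s : ℕ → Set X := fun i => if i = 0 then M else if i = 1 then N else ∅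
  have hs : ∀ i, MeasurableSet (s i) := by
    intro i
    dsimp only [s]
    split_ifs
    exacts [hM, hN, MeasurableSet.empty]
  have hd : Pairwise (Function.onFun Disjoint s) := by
    intro i j hij
    dsimp only [s, Function.onFun]
    split_ifs with h1 h2 h3 h4 h5 h6 <;>
      first | exact hMN | exact hMN.symm | (exfalso; omega) | simp
  have hU : ⋃ i, s i = M ∪ N := by
    ext t
    simp only [Set.mem_iUnion, Set.mem_union]
    constructor
    · rintro ⟨i, hi⟩
      dsimp only [s] at hi
      split_ifs at hi
      exacts [Or.inl hi, Or.inr hi, hi.elim]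
    · rintro (h | h)
      exacts [⟨0, by simpa [s] using h⟩, ⟨1, by simpa [s] using h⟩]
  have h1 := E.hasSum_iUnion s hs hd x
  have h2 : HasSum (fun i => E.toFun (s i) x) (∑ i ∈ Finset.range 2, E.toFun (s i) x) :=
    hasSum_sum_of_ne_finset_zero fun i hi => by
      have : s i = ∅ := by
        simp only [Finset.mem_range, not_lt] at hi
        dsimp only [s]
        rw [if_neg (by omega), if_neg (by omega)]
      rw [this, E.toFun_empty]
  rw [hU] at h1
  simpa [Finset.sum_range_succ, s] using h1.unique h2

theorem toFun_mul_self (E : ProjectionMeasure X V) {M : Set X} (hM : MeasurableSet M) :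
    E.toFun M * E.toFun M = E.toFun M := E.idempotent M hM

/-- With `P = E(M)` and `R = E(N)`, idempotence of `P + R` forces `PR + RP = 0`. Inserting `P = P²`
and anticommuting twice gives `PR = RP` as well, so `2PR = 0`. -/
theorem toFun_mul_of_disjoint (E : ProjectionMeasure X V) {M N : Set X} (hM : MeasurableSet M)
    (hN : MeasurableSet N) (hMN : Disjoint M N) : E.toFun M * E.toFun N = 0 := by
  have h1 := E.toFun_mul_self (hM.union hN)
  rw [E.toFun_union hM hN hMN] at h1
  have hm := E.toFun_mul_self hM
  have hn := E.toFun_mul_self hN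
  set P := E.toFun M
  set R := E.toFun N
  have h2 : P * R + R * P = 0 := by
    have : (P + R) * (P + R) = P * P + R * R + (P * R + R * P) := by noncomm_ring
    rw [this, hm, hn] at h1
    simpa using h1
  have h3 : P * R = -(R * P) := eq_neg_of_add_eq_zero_left h2
  have h4 : P * R = R * P := by
    calc P * R = P * P * R := by rw [hm]
      _ = P * (P * R) := mul_assoc _ _ _
      _ = -(P * R) * P := by rw [h3, mul_neg, ← mul_assoc, h3, neg_neg, neg_mul, neg_neg]
      _ = R * P := by rw [h3, neg_neg, mul_assoc, hm]
  have h5 : (2 : ℝ) • (P * R) = 0 := by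
    rw [two_smul]
    nth_rewrite 2 [h4]
    exact h2
  simpa using h5

theorem toFun_inter (E : ProjectionMeasure X V) {M N : Set X} (hM : MeasurableSet M)
    (hN : MeasurableSet N) : E.toFun (M ∩ N) = E.toFun M * E.toFun N := by
  have h1 : E.toFun M = E.toFun (M ∩ N) + E.toFun (M \ N) := by
    rw [← E.toFun_union (hM.inter hN) (hM.diff hN) Set.disjoint_sdiff_inter.symm,
      Set.inter_union_sdiff]
  have h2 : E.toFun N = E.toFun (M ∩ N) + E.toFun (N \ M) := by
    rw [← E.toFun_union (hM.inter hN) (hN.diff hM)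
      (by rw [Set.inter_comm]; exact Set.disjoint_sdiff_inter.symm), Set.inter_comm,
      Set.inter_union_sdiff]
  rw [h1, h2, add_mul, mul_add, mul_add, E.toFun_mul_self (hM.inter hN),
    E.toFun_mul_of_disjoint (hM.inter hN) (hN.diff hM)
      (Set.disjoint_left.2 fun t h h' => h'.2 h.1),
    E.toFun_mul_of_disjoint (hM.diff hN) (hM.inter hN)
      (Set.disjoint_left.2 fun t h h' => h.2 h'.2),
    E.toFun_mul_of_disjoint (hM.diff hN) (hN.diff hM)
      (Set.disjoint_left.2 fun t h h' => h'.2 h.1)]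
  simp

/-! ### Integrals of simple functions -/

/-- `∫ φ dE` for a real simple function `φ`. -/
noncomputable def integralSimple (E : ProjectionMeasure X V) (φ : SimpleFunc X ℝ) : V →L[ℝ] V :=
  ∑ c ∈ φ.range, c • E.toFun (φ ⁻¹' {c})

/-- `∫ g dE` for a bounded measurable real function `g`. -/
noncomputable def integral (E : ProjectionMeasure X V) (g : X → ℝ) : V →L[ℝ] V :=
  limUnder (uniformApprox g) E.integralSimple

/-- `M ↦ (c ↦ c E(M))`. -/
noncomputable def smulSet (E : ProjectionMeasure X V) (M : Set X) :
    ℝ →L[ℝ] (V →L[ℝ] V) :=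
  ContinuousLinearMap.toSpanSingleton ℝ (E.toFun M)

theorem integralSimple_eq (E : ProjectionMeasure X V) (φ : SimpleFunc X ℝ) :
    E.integralSimple φ = φ.setToSimpleFunc E.smulSet := by
  simp [integralSimple, SimpleFunc.setToSimpleFunc, smulSet]

/-- The zero measure is a dummy: every measurable set has finite measure and every simple function
is integrable for it. The additivity lemmas for `setToSimpleFunc` therefore apply without
restriction. -/
theorem finMeasAdditive_smulSet (E : ProjectionMeasure X V) :
    FinMeasAdditive (0 : Measure X) E.smulSet := by
  intro M N hM hN _ _ hMN
  ext1
  simp [smulSet, E.toFun_union hM hN hMN]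

theorem integralSimple_add (E : ProjectionMeasure X V) (φ ψ : SimpleFunc X ℝ) :
    E.integralSimple (φ + ψ) = E.integralSimple φ + E.integralSimple ψ := by
  simp only [integralSimple_eq]
  exact SimpleFunc.setToSimpleFunc_add _ E.finMeasAdditive_smulSet integrable_zero_measure
    integrable_zero_measure

theorem integralSimple_sub (E : ProjectionMeasure X V) (φ ψ : SimpleFunc X ℝ) :
    E.integralSimple (φ - ψ) = E.integralSimple φ - E.integralSimple ψ := by
  simp only [integralSimple_eq]
  exact SimpleFunc.setToSimpleFunc_sub _ E.finMeasAdditive_smulSet integrable_zero_measure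
    integrable_zero_measure

theorem integralSimple_piecewise (E : ProjectionMeasure X V) {M : Set X} (hM : MeasurableSet M)
    (c : ℝ) : E.integralSimple (SimpleFunc.piecewise M hM (SimpleFunc.const _ c)
      (SimpleFunc.const _ 0)) = c • E.toFun M := by
  have h : E.smulSet ∅ = 0 := by
    ext1
    simp [smulSet, E.toFun_empty_eq]
  rw [integralSimple_eq, SimpleFunc.setToSimpleFunc_indicator _ h]
  simp [smulSet]

theorem integralSimple_const (E : ProjectionMeasure X V) (c : ℝ) :
    E.integralSimple (SimpleFunc.const X c) = c • 1 := by
  have h := E.integralSimple_piecewise MeasurableSet.univ c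
  rw [SimpleFunc.piecewise_univ, E.univ_eq] at h
  exact h

/-- By bilinearity it suffices to treat multiples of indicators, where the claim is `E(M ∩ N) = E(M)
E(N)`. -/
theorem integralSimple_mul (E : ProjectionMeasure X V) (φ ψ : SimpleFunc X ℝ) :
    E.integralSimple (φ * ψ) = E.integralSimple φ * E.integralSimple ψ := by
  induction φ using SimpleFunc.induction with
  | add _ h₁ h₂ => rw [add_mul, integralSimple_add, h₁, h₂, integralSimple_add, add_mul]
  | const c hM =>
    induction ψ using SimpleFunc.induction with
    | add _ h₁ h₂ => rw [mul_add, integralSimple_add, h₁, h₂, integralSimple_add, mul_add]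
    | const d hN =>
      rename_i M N
      have h : SimpleFunc.piecewise M hM (SimpleFunc.const X c) (SimpleFunc.const X 0) *
          SimpleFunc.piecewise N hN (SimpleFunc.const X d) (SimpleFunc.const X 0) =
          SimpleFunc.piecewise (M ∩ N) (hM.inter hN) (SimpleFunc.const X (c * d))
            (SimpleFunc.const X 0) := by
        ext t
        by_cases h1 : t ∈ M <;> by_cases h2 : t ∈ N <;> simp [Set.piecewise, h1, h2]
      rw [h, integralSimple_piecewise, integralSimple_piecewise, integralSimple_piecewise,
        E.toFun_inter hM hN, smul_mul_smul_comm]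

theorem integralSimple_induction (E : ProjectionMeasure X V)
    {p : (V →L[ℝ] V) → Prop}
    (h0 : ∀ (c : ℝ) (M : Set X), MeasurableSet M → p (c • E.toFun M))
    (hadd : ∀ S R, p S → p R → p (S + R)) (φ : SimpleFunc X ℝ) : p (E.integralSimple φ) := by
  induction φ using SimpleFunc.induction with
  | add _ h₁ h₂ => rw [integralSimple_add]; exact hadd _ _ h₁ h₂
  | const c hM => rw [integralSimple_piecewise]; exact h0 _ _ hM

theorem inner_integralSimple_left (E : ProjectionMeasure X V) (φ : SimpleFunc X ℝ)
    (x y : V) :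
    inner ℝ (E.integralSimple φ x) y = inner ℝ x (E.integralSimple φ y) := by
  refine E.integralSimple_induction
    (p := fun S => inner ℝ (S x) y = inner ℝ x (S y)) ?_ ?_ φ
  · intro c M hM
    simp [inner_smul_left, inner_smul_right, E.inner_toFun_left M hM]
  · intro S R hS hR
    simp [inner_add_left, inner_add_right, hS, hR]

theorem inner_integralSimple_nonneg (E : ProjectionMeasure X V) (φ : SimpleFunc X ℝ)
    (hφ : ∀ t, 0 ≤ φ t) (x : V) :
    0 ≤ inner ℝ (E.integralSimple φ x) x := by
  simp only [integralSimple, sum_apply, sum_inner]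
  refine Finset.sum_nonneg fun c hc => ?_
  obtain ⟨t, rfl⟩ := SimpleFunc.mem_range.1 hc
  rw [smul_apply, inner_smul_left]
  exact mul_nonneg (hφ t) (E.inner_toFun_self_nonneg (φ.measurableSet_fiber _) x)

/-- By symmetry and multiplicativity, `‖(∫ φ dE) x‖² = ⟨(∫ φ² dE) x, x⟩`; positivity of the integral
of `C² - φ²` then gives the bound. -/
theorem norm_integralSimple_le (E : ProjectionMeasure X V) (φ : SimpleFunc X ℝ) {C : ℝ}
    (hC0 : 0 ≤ C) (hC : ∀ t, |φ t| ≤ C) : ‖E.integralSimple φ‖ ≤ C := by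
  refine ContinuousLinearMap.opNorm_le_bound _ hC0 fun x => ?_
  refine le_of_sq_le_sq ?_ (by positivity)
  have h := E.inner_integralSimple_nonneg (SimpleFunc.const X (C ^ 2) - φ * φ)
    (fun t => by
      have := sq_le_sq' (abs_le.1 (hC t)).1 (abs_le.1 (hC t)).2
      simp only [SimpleFunc.coe_sub, SimpleFunc.coe_const, SimpleFunc.coe_mul, Pi.sub_apply,
        Pi.mul_apply, Function.const_apply]
      nlinarith) x
  rw [integralSimple_sub, integralSimple_const, integralSimple_mul] at h
  rw [mul_pow, ← real_inner_self_eq_norm_sq, ← E.inner_integralSimple_left]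
  simpa [inner_sub_left, inner_smul_left] using h

/-! ### Uniform limits of simple functions -/

theorem mem_uniformApprox {g : X → ℝ} {s : Set (SimpleFunc X ℝ)} :
    s ∈ uniformApprox g ↔ ∃ ε > 0, ∀ φ : SimpleFunc X ℝ, (∀ t, |φ t - g t| ≤ ε) → φ ∈ s := by
  have hb : (uniformApprox g).HasBasis (fun ε : ℝ => 0 < ε)
      fun ε => {φ | ∀ t, |φ t - g t| ≤ ε} := by
    refine hasBasis_biInf_principal ?_ ⟨1, one_pos (α := ℝ)⟩
    intro a ha b hb
    refine ⟨min a b, lt_min (α := ℝ) ha hb, fun φ hφ t => (hφ t).trans (min_le_left _ _),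
      fun φ hφ t => (hφ t).trans (min_le_right _ _)⟩
  rw [hb.mem_iff]
  rfl

theorem setOf_close_mem_uniformApprox (g : X → ℝ) {ε : ℝ} (hε : 0 < ε) :
    {φ : SimpleFunc X ℝ | ∀ t, |φ t - g t| ≤ ε} ∈ uniformApprox g :=
  mem_uniformApprox.2 ⟨ε, hε, fun _ h => h⟩

theorem exists_simpleFunc_close {g : X → ℝ} (hg : IsBddMeasurable g) {ε : ℝ} (hε : 0 < ε) :
    ∃ φ : SimpleFunc X ℝ, ∀ t, |φ t - g t| ≤ ε := by
  obtain ⟨mg, C, hC⟩ := hg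
  -- Round `g` down to a multiple of `ε`; boundedness leaves only finitely many multiples.
  refine ⟨⟨fun t => ε * (⌊g t / ε⌋ : ℤ), fun c => ?_, ?_⟩, fun t => ?_⟩
  · have : Measurable fun t => ε * ((⌊g t / ε⌋ : ℤ) : ℝ) := by fun_prop
    exact this (measurableSet_singleton c)
  · refine ((Set.finite_Icc (⌊-C / ε⌋) (⌊C / ε⌋)).image fun k : ℤ => ε * (k : ℝ)).subset ?_
    rintro _ ⟨t, rfl⟩
    refine ⟨⌊g t / ε⌋, ⟨Int.floor_mono ?_, Int.floor_mono ?_⟩, rfl⟩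
    · exact div_le_div_of_nonneg_right (abs_le.1 (hC t)).1 hε.le
    · exact div_le_div_of_nonneg_right (abs_le.1 (hC t)).2 hε.le
  · change |ε * ((⌊g t / ε⌋ : ℤ) : ℝ) - g t| ≤ ε
    have h1 := Int.floor_le (g t / ε)
    have h2 := Int.lt_floor_add_one (g t / ε)
    rw [le_div_iff₀ hε] at h1
    rw [div_lt_iff₀ hε] at h2
    rw [abs_le]
    constructor <;> nlinarith

theorem neBot_uniformApprox {g : X → ℝ} (hg : IsBddMeasurable g) : (uniformApprox g).NeBot := by
  rw [neBot_iff]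
  intro h
  have h1 : (∅ : Set (SimpleFunc X ℝ)) ∈ uniformApprox g := by rw [h]; trivial
  obtain ⟨ε, hε, h2⟩ := mem_uniformApprox.1 h1
  obtain ⟨φ, hφ⟩ := exists_simpleFunc_close hg hε
  exact h2 φ hφ

theorem norm_integralSimple_sub_le (E : ProjectionMeasure X V) {g : X → ℝ} {φ ψ : SimpleFunc X ℝ}
    {ε : ℝ} (hε : 0 ≤ ε) (hφ : ∀ t, |φ t - g t| ≤ ε) (hψ : ∀ t, |ψ t - g t| ≤ ε) :
    ‖E.integralSimple φ - E.integralSimple ψ‖ ≤ 2 * ε := by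
  rw [← integralSimple_sub]
  refine E.norm_integralSimple_le _ (by positivity) fun t => ?_
  have h1 := abs_le.1 (hφ t)
  have h2 := abs_le.1 (hψ t)
  simp only [SimpleFunc.coe_sub, Pi.sub_apply]
  rw [abs_le]
  constructor <;> linarith

variable [CompleteSpace V]

theorem tendsto_integral (E : ProjectionMeasure X V) {g : X → ℝ} (hg : IsBddMeasurable g) :
    Tendsto E.integralSimple (uniformApprox g) (𝓝 (E.integral g)) := by
  have := neBot_uniformApprox hg
  refine tendsto_nhds_limUnder (CompleteSpace.complete (f := map E.integralSimple _) ?_)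
  rw [Metric.cauchy_iff]
  refine ⟨inferInstance, fun ε hε => ?_⟩
  -- Two simple functions within `ε / 4` of `g` have integrals within `2 · ε / 4 < ε`.
  refine ⟨_, image_mem_map (setOf_close_mem_uniformApprox g (ε := ε / 4) (by positivity)), ?_⟩
  rintro _ ⟨φ, hφ, rfl⟩ _ ⟨ψ, hψ, rfl⟩
  rw [dist_eq_norm]
  have := E.norm_integralSimple_sub_le (by positivity) hφ hψ
  linarith

theorem integral_add (E : ProjectionMeasure X V) {g h : X → ℝ} (hg : IsBddMeasurable g)
    (hh : IsBddMeasurable h) :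
    E.integral (fun t => g t + h t) = E.integral g + E.integral h := by
  have := neBot_uniformApprox hg
  have := neBot_uniformApprox hh
  have h1 : Tendsto (fun p : SimpleFunc X ℝ × SimpleFunc X ℝ => p.1 + p.2)
      (uniformApprox g ×ˢ uniformApprox h) (uniformApprox fun t => g t + h t) := by
    intro s hs
    rw [mem_map]
    obtain ⟨ε, hε, hs⟩ := mem_uniformApprox.1 hs
    refine mem_of_superset (prod_mem_prod
      (setOf_close_mem_uniformApprox g (ε := ε / 2) (by positivity))
      (setOf_close_mem_uniformApprox h (ε := ε / 2) (by positivity))) ?_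
    rintro ⟨φ, ψ⟩ ⟨hφ, hψ⟩
    refine hs _ fun t => ?_
    have h1 := abs_le.1 (hφ t)
    have h2 := abs_le.1 (hψ t)
    simp only [SimpleFunc.coe_add, Pi.add_apply]
    rw [abs_le]
    constructor <;> linarith
  refine tendsto_nhds_unique ((E.tendsto_integral (hg.add hh)).comp h1) ?_
  refine (((E.tendsto_integral hg).comp tendsto_fst).add
    ((E.tendsto_integral hh).comp tendsto_snd)).congr fun p => ?_
  simp [integralSimple_add]

theorem integral_mul (E : ProjectionMeasure X V) {g h : X → ℝ} (hg : IsBddMeasurable g)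
    (hh : IsBddMeasurable h) :
    E.integral (fun t => g t * h t) = E.integral g * E.integral h := by
  have := neBot_uniformApprox hg
  have := neBot_uniformApprox hh
  have h1 : Tendsto (fun p : SimpleFunc X ℝ × SimpleFunc X ℝ => p.1 * p.2)
      (uniformApprox g ×ˢ uniformApprox h) (uniformApprox fun t => g t * h t) := by
    intro s hs
    rw [mem_map]
    obtain ⟨ε, hε, hs⟩ := mem_uniformApprox.1 hs
    obtain ⟨C, hC⟩ := hg.2
    obtain ⟨D, hD⟩ := hh.2
    -- For `δ = min 1 (ε / K)` the three error terms are at most `δ · 1`, `δ |D|` and `|C| δ`, with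
    -- sum `δ K ≤ ε`.
    set K := 1 + |C| + |D| with hK
    have hK0 : 0 < K := by positivity
    have hδ : 0 < min 1 (ε / K) := by positivity
    refine mem_of_superset (prod_mem_prod (setOf_close_mem_uniformApprox g hδ)
      (setOf_close_mem_uniformApprox h hδ)) ?_
    rintro ⟨φ, ψ⟩ ⟨hφ, hψ⟩
    refine hs _ fun t => ?_
    have h1 := hφ t
    have h2 := hψ t
    simp only [SimpleFunc.coe_mul, Pi.mul_apply]
    have hid : φ t * ψ t - g t * h t =
        (φ t - g t) * (ψ t - h t) + (φ t - g t) * h t + g t * (ψ t - h t) := by ring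
    calc |φ t * ψ t - g t * h t|
        ≤ |φ t - g t| * |ψ t - h t| + |φ t - g t| * |h t| + |g t| * |ψ t - h t| := by
          rw [hid, ← abs_mul, ← abs_mul, ← abs_mul]
          exact abs_add_three _ _ _
      _ ≤ min 1 (ε / K) * 1 + min 1 (ε / K) * |D| + |C| * min 1 (ε / K) := by
          refine add_le_add (add_le_add ?_ ?_) ?_
          · exact mul_le_mul h1 (h2.trans (min_le_left _ _)) (abs_nonneg _) hδ.le
          · exact mul_le_mul h1 ((hD t).trans (le_abs_self _)) (abs_nonneg _) hδ.le
          · exact mul_le_mul ((hC t).trans (le_abs_self _)) h2 (abs_nonneg _) (abs_nonneg _)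
      _ = min 1 (ε / K) * K := by rw [hK]; ring
      _ ≤ ε / K * K := by gcongr; exact min_le_right _ _
      _ = ε := div_mul_cancel₀ _ hK0.ne'
  refine tendsto_nhds_unique ((E.tendsto_integral (hg.mul hh)).comp h1) ?_
  refine (((E.tendsto_integral hg).comp tendsto_fst).mul
    ((E.tendsto_integral hh).comp tendsto_snd)).congr fun p => ?_
  simp [integralSimple_mul]

theorem integral_coe (E : ProjectionMeasure X V) (φ : SimpleFunc X ℝ) :
    E.integral φ = E.integralSimple φ := by
  obtain ⟨C, hC⟩ := φ.exists_forall_norm_le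
  have hφ : IsBddMeasurable φ := ⟨φ.measurable, C, hC⟩
  have := neBot_uniformApprox hφ
  refine tendsto_nhds_unique (E.tendsto_integral hφ) (Metric.tendsto_nhds.2 fun ε hε => ?_)
  refine mem_of_superset (setOf_close_mem_uniformApprox φ (ε := ε / 4) (by positivity)) ?_
  intro ψ hψ
  rw [Set.mem_ofPred_eq, dist_eq_norm]
  have := E.norm_integralSimple_sub_le (by positivity) hψ
    (show ∀ t, |φ t - φ t| ≤ ε / 4 by intro t; simp; positivity)
  linarith

theorem integral_const (E : ProjectionMeasure X V) (c : ℝ) :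
    E.integral (fun _ => c) = c • 1 := by
  rw [← E.integralSimple_const c, ← integral_coe]
  rfl

theorem integral_indicator_one (E : ProjectionMeasure X V) {M : Set X} (hM : MeasurableSet M) :
    E.integral (M.indicator fun _ => 1) = E.toFun M := by
  have h := E.integralSimple_piecewise hM 1
  rw [← integral_coe, one_smul] at h
  rw [← h]
  congr 1

theorem norm_integral_le (E : ProjectionMeasure X V) {g : X → ℝ} (hg : Measurable g) {C : ℝ}
    (hC0 : 0 ≤ C) (hC : ∀ t, |g t| ≤ C) : ‖E.integral g‖ ≤ C := by
  have hb : IsBddMeasurable g := ⟨hg, C, hC⟩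
  have := neBot_uniformApprox hb
  refine le_of_forall_pos_le_add fun ε hε => ?_
  refine le_of_tendsto (E.tendsto_integral hb).norm ?_
  refine mem_of_superset (setOf_close_mem_uniformApprox g hε) fun φ hφ => ?_
  refine E.norm_integralSimple_le _ (by positivity) fun t => ?_
  have h1 := abs_le.1 (hφ t)
  have h2 := abs_le.1 (hC t)
  rw [abs_le]
  constructor <;> linarith

theorem commute_integral (E : ProjectionMeasure X V) {g : X → ℝ} (hg : IsBddMeasurable g)
    {J : V →L[ℝ] V}
    (hJ : ∀ M, MeasurableSet M → J ∘L E.toFun M = E.toFun M ∘L J) :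
    J * E.integral g = E.integral g * J := by
  have := neBot_uniformApprox hg
  have h := E.tendsto_integral hg
  refine tendsto_nhds_unique (h.const_mul J) ((h.mul_const J).congr fun φ => ?_)
  refine E.integralSimple_induction (p := fun S => S * J = J * S) ?_ ?_ φ
  · intro c M hM
    have : J * E.toFun M = E.toFun M * J := hJ M hM
    simp [this]
  · intro S R hS hR
    rw [add_mul, mul_add, hS, hR]

end ProjectionMeasure

/-! ### The spectral integral of bounded complex functions -/

/-- A bounded measurable complex function that is real off `N`. -/
structure IsAdmissible {X : Type*} [MeasurableSpace X] (N : Set X) (F : X → ℂ) : Prop where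
  measurable : Measurable F
  bounded : ∃ C, ∀ t, ‖F t‖ ≤ C
  im_eq_zero : ∀ t, t ∉ N → (F t).im = 0

namespace IsAdmissible

variable {X : Type*} [MeasurableSpace X] {N : Set X} {F G : X → ℂ}

theorem re (hF : IsAdmissible N F) : IsBddMeasurable fun t => (F t).re := by
  obtain ⟨C, hC⟩ := hF.bounded
  exact ⟨Complex.measurable_re.comp hF.measurable, C, fun t =>
    (Complex.abs_re_le_norm _).trans (hC t)⟩

theorem im (hF : IsAdmissible N F) : IsBddMeasurable fun t => (F t).im := by
  obtain ⟨C, hC⟩ := hF.bounded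
  exact ⟨Complex.measurable_im.comp hF.measurable, C, fun t =>
    (Complex.abs_im_le_norm _).trans (hC t)⟩

theorem const (c : ℝ) : IsAdmissible N fun _ : X => (c : ℂ) :=
  ⟨measurable_const, ⟨‖(c : ℂ)‖, fun _ => le_rfl⟩, fun _ _ => Complex.ofReal_im c⟩

theorem add (hF : IsAdmissible N F) (hG : IsAdmissible N G) :
    IsAdmissible N fun t => F t + G t := by
  obtain ⟨C, hC⟩ := hF.bounded
  obtain ⟨D, hD⟩ := hG.bounded
  exact ⟨hF.measurable.add hG.measurable,
    ⟨C + D, fun t => (norm_add_le _ _).trans (add_le_add (hC t) (hD t))⟩,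
    fun t ht => by simp [hF.im_eq_zero t ht, hG.im_eq_zero t ht]⟩

theorem mul (hF : IsAdmissible N F) (hG : IsAdmissible N G) :
    IsAdmissible N fun t => F t * G t := by
  obtain ⟨C, hC⟩ := hF.bounded
  obtain ⟨D, hD⟩ := hG.bounded
  refine ⟨hF.measurable.mul hG.measurable, ⟨C * D, fun t => ?_⟩,
    fun t ht => by simp [hF.im_eq_zero t ht, hG.im_eq_zero t ht]⟩
  rw [norm_mul]
  exact mul_le_mul (hC t) (hD t) (norm_nonneg _) ((norm_nonneg _).trans (hC t))

theorem indicator (hF : Measurable F) (hF0 : ∀ t, t ∉ N → (F t).im = 0) {M : Set X}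
    (hM : MeasurableSet M) {C : ℝ} (hC : ∀ t ∈ M, ‖F t‖ ≤ C) : IsAdmissible N (M.indicator F) := by
  refine ⟨hF.indicator hM, ⟨max C 0, fun t => ?_⟩, fun t ht => ?_⟩ <;> by_cases h : t ∈ M
  · simpa [h] using Or.inl (hC t h)
  · simp [h]
  · simpa [h] using hF0 t ht
  · simp [h]

end IsAdmissible

namespace ProjectionMeasure

variable {X : Type*} [MeasurableSpace X] {V : Type*} [NormedAddCommGroup V]
  [InnerProductSpace ℝ V]

/-- `J` commutes with `E` and squares to `-1` on the range of `E(N)`. -/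
structure IsComplexStructureOn (E : ProjectionMeasure X V) (J : V →L[ℝ] V) (N : Set X) :
    Prop where
  measurableSet : MeasurableSet N
  commute : ∀ M, MeasurableSet M → J ∘L E.toFun M = E.toFun M ∘L J
  sq : J ∘L J ∘L E.toFun N = -E.toFun N

/-- `∫ F dE = ∫ Re F dE + (∫ Im F dE) J` for a bounded measurable complex function `F`. -/
noncomputable def complexIntegral (E : ProjectionMeasure X V) (J : V →L[ℝ] V) (F : X → ℂ) :
    V →L[ℝ] V :=
  E.integral (fun t => (F t).re) + E.integral (fun t => (F t).im) ∘L J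

/-- Countable additivity along the disjoint increments of `s`, whose partial sums telescope to `E(s
k)`. -/
theorem tendsto_toFun (E : ProjectionMeasure X V) {s : ℕ → Set X} (hs : ∀ k, MeasurableSet (s k))
    (hmono : Monotone s) (hU : ⋃ k, s k = Set.univ) (x : V) :
    Tendsto (fun k => E.toFun (s k) x) atTop (𝓝 x) := by
  have h := (E.hasSum_iUnion (disjointed s) (fun k => MeasurableSet.disjointed hs k)
    (disjoint_disjointed s) x).tendsto_sum_nat
  rw [iUnion_disjointed, hU, E.univ_eq] at h
  refine ((tendsto_add_atTop_iff_nat 1).2 h).congr fun k => ?_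
  induction k with
  | zero => simp
  | succ k ih =>
    rw [Finset.sum_range_succ, ih, hmono.disjointed_add_one, ← add_apply,
      ← E.toFun_union (hs k) ((hs _).diff (hs k)) Set.disjoint_sdiff_right, Set.union_sdiff_self,
      Set.union_eq_right.2 (show s k ⊆ s (k + 1) from hmono (Nat.le_succ k))]

variable [CompleteSpace V]

theorem integral_const_mul (E : ProjectionMeasure X V) (c : ℝ) {g : X → ℝ}
    (hg : IsBddMeasurable g) : E.integral (fun t => c * g t) = c • E.integral g := by
  rw [E.integral_mul (IsBddMeasurable.const c) hg, integral_const, smul_one_mul]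

theorem complexIntegral_add (E : ProjectionMeasure X V) (J : V →L[ℝ] V) {N : Set X} {F G : X → ℂ}
    (hF : IsAdmissible N F) (hG : IsAdmissible N G) :
    E.complexIntegral J (fun t => F t + G t) = E.complexIntegral J F + E.complexIntegral J G := by
  simp only [complexIntegral, Complex.add_re, Complex.add_im]
  rw [E.integral_add hF.re hG.re, E.integral_add hF.im hG.im, ContinuousLinearMap.add_comp]
  abel

/-- As `g` vanishes off `N`, its integral absorbs the factor `E(N)`, and `J² E(N) = -E(N)`. No
information on `J²` outside the range of `E(N)` is needed. -/
theorem integral_mul_sq (E : ProjectionMeasure X V) {J : V →L[ℝ] V} {N : Set X}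
    (hJ : E.IsComplexStructureOn J N) {g : X → ℝ} (hg : IsBddMeasurable g)
    (hN : ∀ t, t ∉ N → g t = 0) : E.integral g * (J * J) = -E.integral g := by
  have h1 : E.integral g = E.integral g * E.toFun N := by
    rw [← E.integral_indicator_one hJ.measurableSet,
      ← E.integral_mul hg ((IsBddMeasurable.const 1).indicator hJ.measurableSet)]
    congr 1
    ext t
    by_cases ht : t ∈ N
    · simp [ht]
    · simp [ht, hN t ht]
  have h2 : J * E.toFun N = E.toFun N * J := hJ.commute N hJ.measurableSet
  have h3 : J * (J * E.toFun N) = -E.toFun N := hJ.sq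
  calc E.integral g * (J * J) = E.integral g * (E.toFun N * J * J) := by
        conv_lhs => rw [h1]
        simp only [mul_assoc]
    _ = E.integral g * (J * (J * E.toFun N)) := by rw [← h2, mul_assoc, ← h2]
    _ = -E.integral g := by rw [h3, mul_neg, ← h1]

theorem complexIntegral_mul (E : ProjectionMeasure X V) {J : V →L[ℝ] V} {N : Set X}
    (hJ : E.IsComplexStructureOn J N) {F G : X → ℂ}
    (hF : IsAdmissible N F) (hG : IsAdmissible N G) :
    E.complexIntegral J (fun t => F t * G t) = E.complexIntegral J F * E.complexIntegral J G := by
  have h1 : E.integral (fun t => (F t * G t).re) =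
      E.integral (fun t => (F t).re) * E.integral (fun t => (G t).re) -
      E.integral (fun t => (F t).im) * E.integral (fun t => (G t).im) := by
    have : (fun t => (F t * G t).re) =
        fun t => (F t).re * (G t).re + (-1) * ((F t).im * (G t).im) := by
      ext t
      rw [Complex.mul_re]
      ring
    rw [this, E.integral_add (hF.re.mul hG.re) ((IsBddMeasurable.const _).mul (hF.im.mul hG.im)),
      E.integral_const_mul _ (hF.im.mul hG.im), E.integral_mul hF.re hG.re,
      E.integral_mul hF.im hG.im, neg_one_smul, sub_eq_add_neg]
  have h2 : E.integral (fun t => (F t * G t).im) =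
      E.integral (fun t => (F t).re) * E.integral (fun t => (G t).im) +
      E.integral (fun t => (F t).im) * E.integral (fun t => (G t).re) := by
    simp only [Complex.mul_im]
    rw [E.integral_add (hF.re.mul hG.im) (hF.im.mul hG.re), E.integral_mul hF.re hG.im,
      E.integral_mul hF.im hG.re]
  -- The only place where the product rule needs `J² = -1`: the factor in front vanishes off `N`,
  -- because both imaginary parts do.
  have h3 : E.integral (fun t => (F t).im) * E.integral (fun t => (G t).im) * (J * J) =
      -(E.integral (fun t => (F t).im) * E.integral (fun t => (G t).im)) := by
    rw [← E.integral_mul hF.im hG.im]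
    exact E.integral_mul_sq hJ (hF.im.mul hG.im) fun t ht => by simp [hF.im_eq_zero t ht]
  have h4 := E.commute_integral hG.re hJ.commute
  have h5 := E.commute_integral hG.im hJ.commute
  simp only [complexIntegral, ← ContinuousLinearMap.mul_def]
  rw [h1, h2]
  set a := E.integral fun t => (F t).re
  set b := E.integral fun t => (F t).im
  set c := E.integral fun t => (G t).re
  set d := E.integral fun t => (G t).im
  calc a * c - b * d + (a * d + b * c) * J
      = a * c + b * d * (J * J) + a * d * J + b * (c * J) := by rw [h3]; noncomm_ring
    _ = a * c + b * (d * J) * J + a * d * J + b * (c * J) := by noncomm_ring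
    _ = a * c + b * (J * d) * J + a * d * J + b * (J * c) := by rw [h4, h5]
    _ = (a + b * J) * (c + d * J) := by noncomm_ring

theorem complexIntegral_const (E : ProjectionMeasure X V) (J : V →L[ℝ] V) (c : ℝ) :
    E.complexIntegral J (fun _ => (c : ℂ)) = c • 1 := by
  simp [complexIntegral, integral_const]

theorem complexIntegral_const_mul (E : ProjectionMeasure X V) {J : V →L[ℝ] V} {N : Set X}
    (hJ : E.IsComplexStructureOn J N) {F : X → ℂ} (hF : IsAdmissible N F) (c : ℝ) :
    E.complexIntegral J (fun t => c * F t) = c • E.complexIntegral J F := by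
  rw [E.complexIntegral_mul hJ (IsAdmissible.const c) hF, complexIntegral_const, smul_one_mul]

theorem complexIntegral_indicator_one (E : ProjectionMeasure X V) (J : V →L[ℝ] V) {M : Set X}
    (hM : MeasurableSet M) : E.complexIntegral J (M.indicator fun _ => 1) = E.toFun M := by
  have h1 : (fun t => (M.indicator (fun _ => (1 : ℂ)) t).re) = M.indicator fun _ => (1 : ℝ) := by
    ext t
    by_cases ht : t ∈ M <;> simp [ht]
  have h2 : (fun t => (M.indicator (fun _ => (1 : ℂ)) t).im) = fun _ => (0 : ℝ) := by
    ext t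
    by_cases ht : t ∈ M <;> simp [ht]
  rw [complexIntegral, h1, h2, E.integral_indicator_one hM, integral_const]
  simp

/-- The triangle inequality suffices: the loss of a factor `1 + ‖J‖` is harmless, since only the
existence of bounds matters later. -/
theorem norm_complexIntegral_le (E : ProjectionMeasure X V) (J : V →L[ℝ] V) {F : X → ℂ}
    (hF : Measurable F) {C : ℝ} (hC0 : 0 ≤ C) (hC : ∀ t, ‖F t‖ ≤ C) :
    ‖E.complexIntegral J F‖ ≤ C * (1 + ‖J‖) := by
  have h1 := E.norm_integral_le (Complex.measurable_re.comp hF) hC0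
    fun t => (Complex.abs_re_le_norm _).trans (hC t)
  have h2 := E.norm_integral_le (Complex.measurable_im.comp hF) hC0
    fun t => (Complex.abs_im_le_norm _).trans (hC t)
  calc ‖E.complexIntegral J F‖ ≤ C + C * ‖J‖ :=
        norm_add_le_of_le h1 ((ContinuousLinearMap.opNorm_comp_le _ _).trans
          (mul_le_mul_of_nonneg_right h2 (norm_nonneg J)))
    _ = C * (1 + ‖J‖) := by ring

/-- Multiplication of functions supported in `M` and `L`. -/
theorem complexIntegral_indicator_mul (E : ProjectionMeasure X V) {J : V →L[ℝ] V} {N : Set X}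
    (hJ : E.IsComplexStructureOn J N) {F G : X → ℂ} {M L : Set X}
    (hF : IsAdmissible N (M.indicator F)) (hG : IsAdmissible N (L.indicator G)) :
    E.complexIntegral J (M.indicator F) * E.complexIntegral J (L.indicator G) =
      E.complexIntegral J ((M ∩ L).indicator fun t => F t * G t) := by
  rw [← E.complexIntegral_mul hJ hF hG]
  congr 1
  ext t
  by_cases h1 : t ∈ M <;> by_cases h2 : t ∈ L <;> simp [h1, h2]

theorem toFun_mul_complexIntegral (E : ProjectionMeasure X V) {J : V →L[ℝ] V} {N : Set X}
    (hJ : E.IsComplexStructureOn J N) {F : X → ℂ} {M L : Set X} (hM : MeasurableSet M)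
    (hF : IsAdmissible N (L.indicator F)) :
    E.toFun M * E.complexIntegral J (L.indicator F) =
      E.complexIntegral J ((M ∩ L).indicator F) := by
  rw [← E.complexIntegral_indicator_one J hM, E.complexIntegral_indicator_mul hJ _ hF]
  · simp
  · exact IsAdmissible.indicator measurable_const (by simp) hM fun _ _ => le_rfl

theorem complexIntegral_mul_toFun (E : ProjectionMeasure X V) {J : V →L[ℝ] V} {N : Set X}
    (hJ : E.IsComplexStructureOn J N) {F : X → ℂ} {M L : Set X} (hM : MeasurableSet M)
    (hF : IsAdmissible N (L.indicator F)) :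
    E.complexIntegral J (L.indicator F) * E.toFun M =
      E.complexIntegral J ((L ∩ M).indicator F) := by
  rw [← E.complexIntegral_indicator_one J hM, E.complexIntegral_indicator_mul hJ hF]
  · simp
  · exact IsAdmissible.indicator measurable_const (by simp) hM fun _ _ => le_rfl

end ProjectionMeasure

/-! ### Operators with a spectral integral representation -/

section QuadOp

variable {V : Type*} [NormedAddCommGroup V] [InnerProductSpace ℝ V]

/-- `T² - 2 a T + b` on the domain of `T²`. -/
def quadOp (T : V →ₗ.[ℝ] V) (a b : ℝ) (x : {x : T.domain // T x ∈ T.domain}) : V :=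
  T ⟨T x.1, x.2⟩ - (2 * a) • T x.1 + b • (x.1 : V)

end QuadOp

theorem setOf_norm_le_mono {X : Type*} (l : X → ℂ) {k m : ℕ} (hkm : k ≤ m) :
    {t | ‖l t‖ ≤ k} ⊆ {t | ‖l t‖ ≤ m} :=
  fun t ht => le_trans (show ‖l t‖ ≤ k from ht) (Nat.cast_le.2 hkm)

namespace ProjectionMeasure

variable {X : Type*} [MeasurableSpace X] {V : Type*} [NormedAddCommGroup V]
  [InnerProductSpace ℝ V]

/-- `T = ∫ l dE` for the possibly unbounded function `l`, which is real off `N`. -/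
structure IsIntegralOf (E : ProjectionMeasure X V) (J : V →L[ℝ] V) (N : Set X) (l : X → ℂ)
    (T : V →ₗ.[ℝ] V) : Prop where
  isComplexStructureOn : E.IsComplexStructureOn J N
  measurable : Measurable l
  im_eq_zero : ∀ t, t ∉ N → (l t).im = 0
  -- Of the domain only this is required: it contains the ranges of the truncating projections. Both
  -- `T` and the everywhere defined `∫ F dE` fit.
  mem_domain : ∀ (k : ℕ) (x : V), E.toFun {t | ‖l t‖ ≤ k} x ∈ T.domain
  tendsto : ∀ x : T.domain, Tendsto
    (fun k : ℕ => E.complexIntegral J ({t | ‖l t‖ ≤ k}.indicator l) (x : V)) atTop (𝓝 (T x))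

namespace IsIntegralOf

variable {E : ProjectionMeasure X V} {J : V →L[ℝ] V} {N : Set X} {l : X → ℂ} {T : V →ₗ.[ℝ] V}

theorem measurableSet_norm_le (h : E.IsIntegralOf J N l T) (k : ℕ) :
    MeasurableSet {t | ‖l t‖ ≤ k} :=
  measurableSet_le h.measurable.norm measurable_const

theorem isAdmissible (h : E.IsIntegralOf J N l T) (k : ℕ) :
    IsAdmissible N ({t | ‖l t‖ ≤ k}.indicator l) :=
  IsAdmissible.indicator h.measurable h.im_eq_zero (h.measurableSet_norm_le k) fun _ ht => ht

theorem tendsto_proj (h : E.IsIntegralOf J N l T) (x : V) :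
    Tendsto (fun k : ℕ => E.toFun {t | ‖l t‖ ≤ k} x) atTop (𝓝 x) := by
  refine E.tendsto_toFun h.measurableSet_norm_le (fun i j hij t ht => ?_) ?_ x
  · exact le_trans (show ‖l t‖ ≤ i from ht) (Nat.cast_le.2 hij)
  · refine Set.eq_univ_of_forall fun t => ?_
    obtain ⟨k, hk⟩ := exists_nat_ge ‖l t‖
    exact Set.mem_iUnion.2 ⟨k, hk⟩

theorem isAdmissible_quad (h : E.IsIntegralOf J N l T) (a b : ℝ) (k : ℕ) :
    IsAdmissible N ({t | ‖l t‖ ≤ k}.indicator fun t => l t ^ 2 - 2 * a * l t + b) := by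
  have := h.measurable
  refine IsAdmissible.indicator (by fun_prop) (fun t ht => ?_) (h.measurableSet_norm_le k)
    (C := k ^ 2 + 2 * |a| * k + |b|) fun t ht => ?_
  · simp [pow_two, h.im_eq_zero t ht]
  · have ht : ‖l t‖ ≤ k := ht
    calc ‖l t ^ 2 - 2 * a * l t + b‖ ≤ ‖l t ^ 2‖ + ‖2 * a * l t‖ + ‖(b : ℂ)‖ :=
          (norm_add_le _ _).trans (add_le_add_left (norm_sub_le _ _) _)
      _ = ‖l t‖ ^ 2 + 2 * |a| * ‖l t‖ + |b| := by simp
      _ ≤ _ := by gcongr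

variable [CompleteSpace V]

/-- On the range of `E(|l| ≤ k)` the truncated integrals that converge to `T` are constant from
index `k` on. -/
theorem apply_proj (h : E.IsIntegralOf J N l T) (k : ℕ) (x : V) :
    T ⟨E.toFun {t | ‖l t‖ ≤ k} x, h.mem_domain k x⟩ =
      E.complexIntegral J ({t | ‖l t‖ ≤ k}.indicator l) x := by
  refine tendsto_nhds_unique (h.tendsto _) (tendsto_const_nhds.congr' ?_)
  filter_upwards [eventually_ge_atTop k] with m hm
  have h1 := E.complexIntegral_mul_toFun h.isComplexStructureOn (h.measurableSet_norm_le k)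
    (h.isAdmissible m)
  rw [Set.inter_eq_right.2 (setOf_norm_le_mono l hm)] at h1
  rw [← h1]
  rfl

theorem proj_apply (h : E.IsIntegralOf J N l T) (k : ℕ) (x : T.domain) :
    E.toFun {t | ‖l t‖ ≤ k} (T x) = E.complexIntegral J ({t | ‖l t‖ ≤ k}.indicator l) x := by
  refine tendsto_nhds_unique (((E.toFun _).continuous.tendsto _).comp (h.tendsto x))
    (tendsto_const_nhds.congr' ?_)
  filter_upwards [eventually_ge_atTop k] with m hm
  have h1 := E.toFun_mul_complexIntegral h.isComplexStructureOn (h.measurableSet_norm_le k)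
    (h.isAdmissible m)
  rw [Set.inter_eq_left.2 (setOf_norm_le_mono l hm)] at h1
  rw [← h1]
  rfl

theorem complexIntegral_proj (h : E.IsIntegralOf J N l T) (k : ℕ) :
    E.complexIntegral J ({t | ‖l t‖ ≤ k}.indicator l) * E.toFun {t | ‖l t‖ ≤ k} =
      E.complexIntegral J ({t | ‖l t‖ ≤ k}.indicator l) := by
  rw [E.complexIntegral_mul_toFun h.isComplexStructureOn (h.measurableSet_norm_le k)
    (h.isAdmissible k), Set.inter_self]

theorem proj_complexIntegral (h : E.IsIntegralOf J N l T) (k : ℕ) :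
    E.toFun {t | ‖l t‖ ≤ k} * E.complexIntegral J ({t | ‖l t‖ ≤ k}.indicator l) =
      E.complexIntegral J ({t | ‖l t‖ ≤ k}.indicator l) := by
  rw [E.toFun_mul_complexIntegral h.isComplexStructureOn (h.measurableSet_norm_le k)
    (h.isAdmissible k), Set.inter_self]

theorem complexIntegral_quad (h : E.IsIntegralOf J N l T) (a b : ℝ) (k : ℕ) :
    E.complexIntegral J ({t | ‖l t‖ ≤ k}.indicator fun t => l t ^ 2 - 2 * a * l t + b) =
      E.complexIntegral J ({t | ‖l t‖ ≤ k}.indicator l) *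
        E.complexIntegral J ({t | ‖l t‖ ≤ k}.indicator l) -
      (2 * a) • E.complexIntegral J ({t | ‖l t‖ ≤ k}.indicator l) +
      b • E.toFun {t | ‖l t‖ ≤ k} := by
  set M := {t | ‖l t‖ ≤ k}
  have hM : MeasurableSet M := h.measurableSet_norm_le k
  have hl : IsAdmissible N (M.indicator l) := h.isAdmissible k
  have h1 : IsAdmissible N (M.indicator fun _ => 1) :=
    IsAdmissible.indicator measurable_const (by simp) hM fun _ _ => le_rfl
  have hJ := h.isComplexStructureOn
  have hc : ∀ (c : ℝ) {F : X → ℂ}, IsAdmissible N F → IsAdmissible N fun t => (c : ℂ) * F t :=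
    fun c F hF => (IsAdmissible.const c).mul hF
  have h2 : (M.indicator fun t => l t ^ 2 - 2 * a * l t + b) = fun t =>
      (M.indicator l t * M.indicator l t + ((-(2 * a) : ℝ) : ℂ) * M.indicator l t) +
        (b : ℂ) * M.indicator (fun _ => 1) t := by
    ext t
    by_cases ht : t ∈ M
    · simp only [ht, Set.indicator_of_mem]
      push_cast
      ring
    · simp [ht]
  rw [h2, E.complexIntegral_add J ((hl.mul hl).add (hc _ hl)) (hc _ h1),
    E.complexIntegral_add J (hl.mul hl) (hc _ hl), E.complexIntegral_mul hJ hl hl,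
    E.complexIntegral_const_mul hJ hl, E.complexIntegral_const_mul hJ h1,
    E.complexIntegral_indicator_one J hM, neg_smul, sub_eq_add_neg]

/-- Together with `quadOp_proj`, this reduces the unbounded quadratic operator to the bounded
calculus: compressed to `|l| ≤ k` from either side, it is the integral of its truncated symbol. -/
theorem proj_quadOp (h : E.IsIntegralOf J N l T) (a b : ℝ) (k : ℕ)
    (x : {x : T.domain // T x ∈ T.domain}) :
    E.toFun {t | ‖l t‖ ≤ k} (quadOp T a b x) =
      E.complexIntegral J ({t | ‖l t‖ ≤ k}.indicator fun t => l t ^ 2 - 2 * a * l t + b) x.1 := by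
  have h1 : E.toFun {t | ‖l t‖ ≤ k} (T ⟨T x.1, x.2⟩) =
      E.complexIntegral J ({t | ‖l t‖ ≤ k}.indicator l)
        (E.complexIntegral J ({t | ‖l t‖ ≤ k}.indicator l) x.1) := by
    rw [h.proj_apply, ← h.proj_apply k x.1]
    conv_lhs => rw [← h.complexIntegral_proj]
    rfl
  rw [h.complexIntegral_quad, quadOp, map_add, map_sub, map_smul, map_smul, h1, h.proj_apply]
  rfl

theorem apply_proj_mem_domain (h : E.IsIntegralOf J N l T) (k : ℕ) (x : V) :
    T ⟨E.toFun {t | ‖l t‖ ≤ k} x, h.mem_domain k x⟩ ∈ T.domain := by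
  rw [h.apply_proj, ← h.proj_complexIntegral]
  exact h.mem_domain k _

theorem quadOp_proj (h : E.IsIntegralOf J N l T) (a b : ℝ) (k : ℕ) (x : V) :
    quadOp T a b ⟨⟨E.toFun {t | ‖l t‖ ≤ k} x, h.mem_domain k x⟩, h.apply_proj_mem_domain k x⟩ =
      E.complexIntegral J ({t | ‖l t‖ ≤ k}.indicator fun t => l t ^ 2 - 2 * a * l t + b) x := by
  have h1 : T ⟨T ⟨E.toFun {t | ‖l t‖ ≤ k} x, h.mem_domain k x⟩, h.apply_proj_mem_domain k x⟩ =
      E.complexIntegral J ({t | ‖l t‖ ≤ k}.indicator l)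
        (E.complexIntegral J ({t | ‖l t‖ ≤ k}.indicator l) x) := by
    rw [← h.apply_proj]
    congr 2
    rw [h.apply_proj]
    conv_lhs => rw [← h.proj_complexIntegral]
    rfl
  rw [h.complexIntegral_quad, quadOp, h1, h.apply_proj]
  rfl

/-- If `l² - 2 a l + b` is bounded below by `c > 0` on a set of full measure, then
`(T² - 2 a T + b)⁻¹` exists and is bounded and densely defined. -/
theorem quadOp_invertible (h : E.IsIntegralOf J N l T) {a b c : ℝ} (hc : 0 < c)
    (hE : E.toFun {t | ‖l t ^ 2 - 2 * a * l t + b‖ < c} = 0) :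
    (∀ x, ‖(x.1 : V)‖ ≤ c⁻¹ * (1 + ‖J‖) * ‖quadOp T a b x‖) ∧ DenseRange (quadOp T a b) := by
  set q : X → ℂ := fun t => l t ^ 2 - 2 * a * l t + b with hq
  have hl := h.measurable
  have hJ := h.isComplexStructureOn
  have hqm : Measurable q := by fun_prop
  have hq0 : ∀ t, t ∉ N → (q t).im = 0 := fun t ht => by
    simp [hq, pow_two, h.im_eq_zero t ht]
  let G : Set X := {t | c ≤ ‖q t‖}
  have hG : MeasurableSet G := measurableSet_le measurable_const hqm.norm
  have hEG : E.toFun G = 1 := by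
    have h1 := E.toFun_union hG hG.compl disjoint_compl_right
    have h2 : Gᶜ = {t | ‖q t‖ < c} := by
      ext t
      simp [G]
    rw [Set.union_compl_self, E.univ_eq, h2, hE, add_zero] at h1
    exact h1.symm
  let M : ℕ → Set X := fun k => {t | ‖l t‖ ≤ k}
  have hM : ∀ k, MeasurableSet (M k) := h.measurableSet_norm_le
  have hinv : ∀ t ∈ G, ‖(q t)⁻¹‖ ≤ c⁻¹ := fun t ht => by
    rw [norm_inv]
    exact inv_anti₀ hc ht
  have hinv0 : ∀ t, t ∉ N → ((q t)⁻¹).im = 0 := fun t ht => by simp [hq0 t ht]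
  -- The integrals of `1 / q` over `G ∩ M k` are truncated resolvents: they invert `q(T)` on the
  -- range of `E(M k)`, and `c⁻¹ (1 + ‖J‖)` bounds them uniformly in `k`.
  have hR : ∀ k, IsAdmissible N ((G ∩ M k).indicator fun t => (q t)⁻¹) := fun k =>
    IsAdmissible.indicator hqm.inv hinv0 (hG.inter (hM k)) fun t ht => hinv t ht.1
  have hRn : ∀ k, ‖E.complexIntegral J ((G ∩ M k).indicator fun t => (q t)⁻¹)‖ ≤
      c⁻¹ * (1 + ‖J‖) := fun k => by
    refine E.norm_complexIntegral_le J (hR k).measurable (by positivity) fun t => ?_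
    by_cases ht : t ∈ G ∩ M k
    · simpa [ht] using hinv t ht.1
    · simp [ht, hc.le]
  have hone : ∀ k, E.complexIntegral J ((G ∩ M k).indicator fun _ => 1) = E.toFun (M k) := by
    intro k
    rw [E.complexIntegral_indicator_one J (hG.inter (hM k)), E.toFun_inter hG (hM k), hEG, one_mul]
  have hne : ∀ t ∈ G, q t ≠ 0 := fun t ht h0 => by
    have : c ≤ ‖q t‖ := ht
    simp [h0] at this
    linarith
  have hL : ∀ k, E.complexIntegral J ((G ∩ M k).indicator fun t => (q t)⁻¹) *
      E.complexIntegral J ((M k).indicator q) = E.toFun (M k) := fun k => by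
    rw [E.complexIntegral_indicator_mul hJ (hR k) (h.isAdmissible_quad a b k), ← hone k]
    congr 1
    rw [Set.inter_assoc, Set.inter_self]
    exact Set.indicator_congr fun t ht => inv_mul_cancel₀ (hne t ht.1)
  have hL' : ∀ k, E.complexIntegral J ((M k).indicator q) *
      E.complexIntegral J ((G ∩ M k).indicator fun t => (q t)⁻¹) = E.toFun (M k) := fun k => by
    rw [E.complexIntegral_indicator_mul hJ (h.isAdmissible_quad a b k) (hR k), ← hone k]
    congr 1
    rw [Set.inter_left_comm, Set.inter_self]
    exact Set.indicator_congr fun t ht => mul_inv_cancel₀ (hne t ht.1)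
  have hRP : ∀ k, E.complexIntegral J ((G ∩ M k).indicator fun t => (q t)⁻¹) * E.toFun (M k) =
      E.complexIntegral J ((G ∩ M k).indicator fun t => (q t)⁻¹) := fun k => by
    rw [E.complexIntegral_mul_toFun hJ (hM k) (hR k), Set.inter_assoc, Set.inter_self]
  constructor
  · intro x
    refine le_of_tendsto (h.tendsto_proj x.1).norm (Eventually.of_forall fun k => ?_)
    have h1 : E.toFun (M k) (x.1 : V) =
        E.complexIntegral J ((G ∩ M k).indicator fun t => (q t)⁻¹) (quadOp T a b x) := by
      rw [← hL]
      conv_rhs => rw [← hRP]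
      exact congrArg (E.complexIntegral J ((G ∩ M k).indicator fun t => (q t)⁻¹))
        (h.proj_quadOp a b k x).symm
    change ‖E.toFun (M k) (x.1 : V)‖ ≤ _
    rw [h1]
    exact ContinuousLinearMap.le_of_opNorm_le _ (hRn k) _
  · intro y
    -- Each `E(M k) y` is in the range, as the image of the truncated resolvent applied to `y`, and
    -- these vectors converge to `y`.
    refine mem_closure_of_tendsto (h.tendsto_proj y) (Eventually.of_forall fun k => ?_)
    refine ⟨_, (h.quadOp_proj a b k
      (E.complexIntegral J ((G ∩ M k).indicator fun t => (q t)⁻¹) y)).trans ?_⟩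
    exact congrArg (fun S : V →L[ℝ] V => S y) (hL' k)

/-- If `T² - 2 a T + b` is bounded below, then `l² - 2 a l + b` is bounded below on a set of
full measure. -/
theorem exists_toFun_eq_zero (h : E.IsIntegralOf J N l T) {a b C : ℝ}
    (hC : ∀ x, ‖(x.1 : V)‖ ≤ C * ‖quadOp T a b x‖) :
    ∃ c > 0, E.toFun {t | ‖l t ^ 2 - 2 * a * l t + b‖ < c} = 0 := by
  have hl := h.measurable
  have hJ := h.isComplexStructureOn
  have hK : 0 < 2 * ((1 + ‖J‖) * (1 + |C|)) := by positivity
  -- Where the symbol is smaller than `c`, the lower bound gives `‖z‖ ≤ (1 + |C|) c (1 + ‖J‖) ‖z‖`,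
  -- and this `c` makes the right side `‖z‖ / 2`. Using `1 + |C|` for `C` avoids any sign condition
  -- on `C`.
  set c := (2 * ((1 + ‖J‖) * (1 + |C|)))⁻¹ with hcdef
  have hc : 0 < c := inv_pos.2 hK
  refine ⟨c, hc, ?_⟩
  set q : X → ℂ := fun t => l t ^ 2 - 2 * a * l t + b with hq
  have hqm : Measurable q := by fun_prop
  have hU : MeasurableSet {t | ‖q t‖ < c} := measurableSet_lt hqm.norm measurable_const
  set U := {t | ‖q t‖ < c}
  ext1 y
  refine tendsto_nhds_unique (h.tendsto_proj (E.toFun U y)) (tendsto_const_nhds.congr fun k => ?_)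
  have hM := h.measurableSet_norm_le k
  have hx := hC ⟨⟨E.toFun {t | ‖l t‖ ≤ k} (E.toFun U y), h.mem_domain k _⟩,
    h.apply_proj_mem_domain k _⟩
  rw [h.quadOp_proj] at hx
  set M := {t | ‖l t‖ ≤ k}
  have hadm : IsAdmissible N (M.indicator q) := h.isAdmissible_quad a b k
  have hadm2 : IsAdmissible N ((M ∩ U).indicator q) :=
    IsAdmissible.indicator hqm (fun t ht => by simp [hq, pow_two, h.im_eq_zero t ht])
      (hM.inter hU) fun t ht => le_of_lt ht.2
  have h1 : E.complexIntegral J (M.indicator q) * E.toFun U =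
      E.complexIntegral J ((M ∩ U).indicator q) * (E.toFun M * E.toFun U) := by
    rw [← E.toFun_inter hM hU, E.complexIntegral_mul_toFun hJ (hM.inter hU) hadm2, Set.inter_self,
      E.complexIntegral_mul_toFun hJ hU hadm]
  have h2 : E.complexIntegral J (M.indicator q) (E.toFun U y) =
      E.complexIntegral J ((M ∩ U).indicator q) (E.toFun M (E.toFun U y)) :=
    congrArg (fun S : V →L[ℝ] V => S y) h1
  have h3 : ‖E.complexIntegral J ((M ∩ U).indicator q)‖ ≤ c * (1 + ‖J‖) := by
    refine E.norm_complexIntegral_le J hadm2.measurable hc.le fun t => ?_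
    by_cases ht : t ∈ M ∩ U
    · simpa [ht] using le_of_lt ht.2
    · simp [ht, hc.le]
  set z := E.toFun M (E.toFun U y)
  have h4 : ‖z‖ ≤ (1 + |C|) * (c * (1 + ‖J‖) * ‖z‖) := by
    refine hx.trans ?_
    rw [show E.complexIntegral J (M.indicator fun t => l t ^ 2 - 2 * a * l t + b) (E.toFun U y) =
      E.complexIntegral J ((M ∩ U).indicator q) z from h2]
    exact mul_le_mul (by linarith [le_abs_self C]) (ContinuousLinearMap.le_of_opNorm_le _ h3 _)
      (norm_nonneg _) (by positivity)
  have h5 : (1 + |C|) * (c * (1 + ‖J‖) * ‖z‖) = ‖z‖ / 2 := by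
    rw [hcdef]
    field_simp
  rw [h5] at h4
  have h6 : z = 0 := norm_le_zero_iff.1 (by linarith)
  exact h6.symm

/-- If `T` is bounded, then `l` is bounded on a set of full measure. -/
theorem exists_toFun_norm_eq_zero (h : E.IsIntegralOf J N l T) {C : ℝ}
    (hC : ∀ x : T.domain, ‖T x‖ ≤ C * ‖(x : V)‖) :
    ∃ R : ℝ, E.toFun {t | R < ‖l t‖} = 0 := by
  have hl := h.measurable
  have hJ := h.isComplexStructureOn
  -- Where `|l| > R`, integrating `1 / l` inverts `T` with norm at most `R⁻¹ (1 + ‖J‖)`. Boundedness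
  -- of `T` then gives `‖z‖ ≤ ‖z‖ / 2`.
  set R := 2 * ((1 + ‖J‖) * (1 + |C|)) with hRdef
  have hR : 0 < R := by positivity
  refine ⟨R, ?_⟩
  have hU : MeasurableSet {t | R < ‖l t‖} := measurableSet_lt measurable_const hl.norm
  set U := {t | R < ‖l t‖}
  ext1 y
  refine tendsto_nhds_unique (h.tendsto_proj (E.toFun U y)) (tendsto_const_nhds.congr fun k => ?_)
  have hM := h.measurableSet_norm_le k
  have hx := hC ⟨E.toFun {t | ‖l t‖ ≤ k} (E.toFun U y), h.mem_domain k _⟩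
  rw [h.apply_proj] at hx
  have hadm := h.isAdmissible k
  set M := {t | ‖l t‖ ≤ k}
  have hinv : ∀ t ∈ U, ‖(l t)⁻¹‖ ≤ R⁻¹ := fun t ht => by
    rw [norm_inv]
    exact inv_anti₀ hR (le_of_lt ht)
  have hadm2 : IsAdmissible N (U.indicator fun t => (l t)⁻¹) :=
    IsAdmissible.indicator hl.inv (fun t ht => by simp [h.im_eq_zero t ht]) hU hinv
  have h1 : E.complexIntegral J (U.indicator fun t => (l t)⁻¹) *
      E.complexIntegral J (M.indicator l) = E.toFun M * E.toFun U := by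
    rw [E.complexIntegral_indicator_mul hJ hadm2 hadm, ← E.toFun_inter hM hU,
      ← E.complexIntegral_indicator_one J (hM.inter hU), Set.inter_comm]
    congr 1
    refine Set.indicator_congr fun t ht => inv_mul_cancel₀ fun h0 => ?_
    have : R < ‖l t‖ := ht.2
    rw [h0, norm_zero] at this
    linarith
  have h2 : E.complexIntegral J (U.indicator fun t => (l t)⁻¹)
      (E.complexIntegral J (M.indicator l) (E.toFun U y)) = E.toFun M (E.toFun U y) := by
    have := congrArg (fun S : V →L[ℝ] V => S (E.toFun U y)) h1
    have h3 : E.toFun U (E.toFun U y) = E.toFun U y :=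
      congrArg (fun S : V →L[ℝ] V => S y) (E.toFun_mul_self hU)
    simpa [h3] using this
  have h3 : ‖E.complexIntegral J (U.indicator fun t => (l t)⁻¹)‖ ≤ R⁻¹ * (1 + ‖J‖) := by
    refine E.norm_complexIntegral_le J hadm2.measurable (by positivity) fun t => ?_
    by_cases ht : t ∈ U
    · simpa [ht] using hinv t ht
    · simp [ht, hR.le]
  have h4 := ContinuousLinearMap.le_of_opNorm_le _ h3
    (E.complexIntegral J (M.indicator l) (E.toFun U y))
  rw [h2] at h4
  set z := E.toFun M (E.toFun U y)
  have h5 : ‖z‖ ≤ R⁻¹ * (1 + ‖J‖) * ((1 + |C|) * ‖z‖) := by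
    refine h4.trans (mul_le_mul_of_nonneg_left (hx.trans ?_) (by positivity))
    exact mul_le_mul_of_nonneg_right (by linarith [le_abs_self C]) (norm_nonneg _)
  have h6 : R⁻¹ * (1 + ‖J‖) * ((1 + |C|) * ‖z‖) = ‖z‖ / 2 := by
    rw [hRdef]
    field_simp
  rw [h6] at h5
  have h7 : z = 0 := norm_le_zero_iff.1 (by linarith)
  exact h7.symm

end IsIntegralOf

/-- A bounded operator `∫ F dE` as an operator with domain. -/
theorem isIntegralOf_complexIntegral [CompleteSpace V] {E : ProjectionMeasure X V} {J : V →L[ℝ] V}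
    {N : Set X} {F : X → ℂ} (hJ : E.IsComplexStructureOn J N) (hF : IsAdmissible N F) :
    E.IsIntegralOf J N F ((E.complexIntegral J F : V →ₗ[ℝ] V).toPMap ⊤) where
  isComplexStructureOn := hJ
  measurable := hF.measurable
  im_eq_zero := hF.im_eq_zero
  mem_domain := fun _ _ => Submodule.mem_top
  tendsto := fun x => by
    obtain ⟨C, hC⟩ := hF.bounded
    obtain ⟨k, hk⟩ := exists_nat_ge C
    refine tendsto_const_nhds.congr' ?_
    filter_upwards [eventually_ge_atTop k] with m hm
    -- Beyond a bound of `F` the truncation does nothing.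
    have : {t | ‖F t‖ ≤ m}.indicator F = F := by
      rw [Set.indicator_eq_self]
      exact fun t _ => (hC t).trans (hk.trans (Nat.cast_le.2 hm))
    rw [this]
    rfl

end ProjectionMeasure

/-! ### The plane `ℂ_I` -/

section Slice

variable {n : ℕ} {I : Cl n}

theorem one_apply_empty : (1 : Cl n) ∅ = 1 := by simp [one_def, e_apply]

theorem inner_one_right (a : Cl n) : inner ℝ a 1 = a ∅ := by
  rw [one_def, e, EuclideanSpace.inner_single_right]
  simp

theorem norm_one_eq : ‖(1 : Cl n)‖ = 1 := by simp [one_def, e]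

theorem one_mem_paravectors : (1 : Cl n) ∈ paravectors n := by
  intro A hA
  rw [one_def, e_apply, if_neg]
  rintro rfl
  simp at hA

theorem add_smul_mem_paravectors (hI : I ∈ unitSphere n) (u v : ℝ) :
    u • 1 + v • I ∈ paravectors n := by
  intro A hA
  simp [one_mem_paravectors A hA, hI.1 A hA]

theorem add_smul_apply_empty (hI : I ∈ unitSphere n) (u v : ℝ) :
    (u • 1 + v • I : Cl n) ∅ = u := by
  simp [hI.2.1, one_apply_empty]

theorem inner_add_smul (hI : I ∈ unitSphere n) (u v : ℝ) :
    inner ℝ I (u • 1 + v • I) = v := by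
  rw [inner_add_right, inner_smul_right, inner_smul_right, inner_one_right, hI.2.1,
    real_inner_self_eq_norm_sq, hI.2.2]
  ring

theorem norm_add_smul_sq (hI : I ∈ unitSphere n) (u v : ℝ) :
    ‖u • 1 + v • I‖ ^ 2 = u ^ 2 + v ^ 2 := by
  rw [norm_add_sq_real, inner_smul_left, inner_smul_right, real_inner_comm, inner_one_right,
    hI.2.1, norm_smul, norm_smul, hI.2.2, norm_one_eq]
  simp

theorem neg_mem_unitSphere (hI : I ∈ unitSphere n) : -I ∈ unitSphere n :=
  ⟨fun A hA => by simp [hI.1 A hA], by simp [hI.2.1], by simp [hI.2.2]⟩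

/-- The complex number `u + i v` that corresponds to `u + I v`. -/
noncomputable def sliceCoord (I w : Cl n) : ℂ := ⟨w ∅, inner ℝ I w⟩

/-- The conjugation `u + I v ↦ u - I v` of the plane `ℂ_I`. -/
noncomputable def sliceConj (I w : Cl n) : Cl n := w ∅ • 1 + (-inner ℝ I w) • I

theorem continuous_sliceCoord (I : Cl n) : Continuous (sliceCoord I) := by
  have h : sliceCoord I = fun w => Complex.equivRealProdCLM.symm (w ∅, inner ℝ I w) := by
    ext w
    apply Complex.ext <;> simp [sliceCoord]
  rw [h]
  fun_prop

theorem continuous_sliceConj (I : Cl n) : Continuous (sliceConj I) := by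
  unfold sliceConj
  fun_prop

theorem mem_slice_of_mem_upperSlice {w : Cl n} (hw : w ∈ upperSlice I) : w ∈ slice I := by
  obtain ⟨u, v, -, h⟩ := hw
  exact ⟨u, v, h⟩

theorem sub_mem_slice {w z : Cl n} (hw : w ∈ slice I) (hz : z ∈ slice I) : w - z ∈ slice I := by
  obtain ⟨u, v, rfl⟩ := hw
  obtain ⟨p, q, rfl⟩ := hz
  exact ⟨u - p, v - q, by module⟩

theorem sliceCoord_sub (w z : Cl n) : sliceCoord I (w - z) = sliceCoord I w - sliceCoord I z := by
  apply Complex.ext <;> simp [sliceCoord, inner_sub_right]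

theorem norm_sliceCoord (hI : I ∈ unitSphere n) {w : Cl n} (hw : w ∈ slice I) :
    ‖sliceCoord I w‖ = ‖w‖ := by
  obtain ⟨u, v, rfl⟩ := hw
  rw [← sq_eq_sq₀ (norm_nonneg _) (norm_nonneg _), norm_add_smul_sq hI, Complex.sq_norm,
    Complex.normSq_apply, sliceCoord, add_smul_apply_empty hI, inner_add_smul hI]
  ring

theorem norm_sliceCoord_sub (hI : I ∈ unitSphere n) {w z : Cl n} (hw : w ∈ slice I)
    (hz : z ∈ slice I) : ‖sliceCoord I w - sliceCoord I z‖ = ‖w - z‖ := by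
  rw [← sliceCoord_sub, norm_sliceCoord hI (sub_mem_slice hw hz)]

theorem sliceConj_add_smul (hI : I ∈ unitSphere n) (u v : ℝ) :
    sliceConj I (u • 1 + v • I) = u • 1 + (-v) • I := by
  rw [sliceConj, add_smul_apply_empty hI, inner_add_smul hI]

theorem sliceCoord_sliceConj (hI : I ∈ unitSphere n) (w : Cl n) :
    sliceCoord I (sliceConj I w) = (starRingEnd ℂ) (sliceCoord I w) := by
  apply Complex.ext
  · simp [sliceCoord, sliceConj, hI.2.1, one_apply_empty]
  · exact inner_add_smul hI _ _

theorem sliceConj_mem_slice (I w : Cl n) : sliceConj I w ∈ slice I := ⟨_, _, rfl⟩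

theorem sliceConj_sliceConj (hI : I ∈ unitSphere n) {w : Cl n} (hw : w ∈ slice I) :
    sliceConj I (sliceConj I w) = w := by
  obtain ⟨u, v, rfl⟩ := hw
  rw [sliceConj_add_smul hI, sliceConj_add_smul hI, neg_neg]

theorem mem_upperSlice_or (hI : I ∈ unitSphere n) {w : Cl n} (hw : w ∈ slice I) :
    w ∈ upperSlice I ∨ sliceConj I w ∈ upperSlice I := by
  obtain ⟨u, v, rfl⟩ := hw
  rcases le_total 0 v with hv | hv
  · exact Or.inl ⟨u, v, hv, rfl⟩
  · exact Or.inr ⟨u, -v, by linarith, sliceConj_add_smul hI u v⟩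

theorem mem_upperSlice_iff (hI : I ∈ unitSphere n) {w : Cl n} :
    w ∈ upperSlice I ↔ w ∈ slice I ∧ 0 ≤ inner ℝ I w := by
  constructor
  · rintro ⟨u, v, hv, rfl⟩
    exact ⟨⟨u, v, rfl⟩, by rwa [inner_add_smul hI]⟩
  · rintro ⟨⟨u, v, rfl⟩, hv⟩
    rw [inner_add_smul hI] at hv
    exact ⟨u, v, hv, rfl⟩

theorem slice_subset_paravectors (hI : I ∈ unitSphere n) : slice I ⊆ paravectors n := by
  rintro _ ⟨u, v, rfl⟩
  exact add_smul_mem_paravectors hI u v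

/-- The quadratic polynomial of `s ∈ ℂ_I` splits over `ℂ`. -/
theorem quad_eq_mul (hI : I ∈ unitSphere n) {s : Cl n} (hs : s ∈ slice I) (z : ℂ) :
    z ^ 2 - 2 * (s ∅ : ℝ) * z + ((‖s‖ ^ 2 : ℝ) : ℂ) =
      (z - sliceCoord I s) * (z - (starRingEnd ℂ) (sliceCoord I s)) := by
  have h1 : ((s ∅ : ℝ) : ℂ) * 2 = sliceCoord I s + (starRingEnd ℂ) (sliceCoord I s) := by
    rw [Complex.add_conj]
    simp [sliceCoord, mul_comm]
  have h2 : ((‖s‖ ^ 2 : ℝ) : ℂ) = sliceCoord I s * (starRingEnd ℂ) (sliceCoord I s) := by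
    rw [Complex.mul_conj, Complex.normSq_eq_norm_sq, norm_sliceCoord hI hs]
  rw [h2]
  linear_combination (-z) * h1

/-- The squares of the two sides differ by `4 Im z Im w ≥ 0`. -/
theorem norm_sub_le_norm_sub_conj {z w : ℂ} (hz : 0 ≤ z.im) (hw : 0 ≤ w.im) :
    ‖z - w‖ ≤ ‖z - (starRingEnd ℂ) w‖ := by
  rw [← sq_le_sq₀ (norm_nonneg _) (norm_nonneg _), Complex.sq_norm, Complex.sq_norm,
    Complex.normSq_apply, Complex.normSq_apply]
  simp only [Complex.sub_re, Complex.sub_im, Complex.conj_re, Complex.conj_im]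
  nlinarith [mul_nonneg hz hw]

end Slice

/-! ### The `S`-spectrum of operators with a spectral integral representation -/

section Spectrum

variable {H : Type*} [NormedAddCommGroup H] [InnerProductSpace ℝ H] {n : ℕ} {I : Cl n}

/-- `Q_s` depends on `s` only through its real part and its norm; this is the source of axial
symmetry. -/
theorem mem_sSpectrum_of_eq (T : CliffordModule H n →ₗ.[ℝ] CliffordModule H n) {s p : Cl n}
    (hs : s ∈ sSpectrum T) (hp : p ∈ paravectors n) (h0 : p ∅ = s ∅) (h1 : ‖p‖ = ‖s‖) :
    p ∈ sSpectrum T := by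
  have hQ : Q T p = Q T s := by
    ext1 x
    rw [Q, Q, h0, h1]
  refine ⟨hp, fun h => hs.2 ⟨hs.1, ?_⟩⟩
  have := h.2
  rwa [hQ] at this

theorem add_smul_mem_sSpectrum (T : CliffordModule H n →ₗ.[ℝ] CliffordModule H n)
    (hI : I ∈ unitSphere n) {K : Cl n} (hK : K ∈ unitSphere n) {u v : ℝ}
    (h : u • 1 + v • I ∈ sSpectrum T) : u • 1 + v • K ∈ sSpectrum T := by
  refine mem_sSpectrum_of_eq T h (add_smul_mem_paravectors hK u v) ?_ ?_
  · rw [add_smul_apply_empty hI, add_smul_apply_empty hK]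
  · rw [← sq_eq_sq₀ (norm_nonneg _) (norm_nonneg _), norm_add_smul_sq hI, norm_add_smul_sq hK]

theorem sliceConj_mem (T : CliffordModule H n →ₗ.[ℝ] CliffordModule H n)
    (hI : I ∈ unitSphere n) {p : Cl n} (hp : p ∈ sSpectrum T ∩ slice I) :
    sliceConj I p ∈ sSpectrum T ∩ slice I := by
  refine ⟨?_, sliceConj_mem_slice I p⟩
  obtain ⟨h, u, v, rfl⟩ := hp
  rw [sliceConj_add_smul hI, neg_smul, ← smul_neg]
  exact add_smul_mem_sSpectrum T hI (neg_mem_unitSphere hI) h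

namespace IsIntrinsicOn

variable {T : CliffordModule H n →ₗ.[ℝ] CliffordModule H n} {f : Cl n → Cl n}

theorem exists_eq (hf : IsIntrinsicOn f (sSpectrum T)) (hI : I ∈ unitSphere n) {u v : ℝ}
    (h : u • 1 + v • I ∈ sSpectrum T) : ∃ a b : ℝ, f (u • 1 + v • I) = a • 1 + b • I ∧
      f (u • 1 + (-v) • I) = a • 1 + (-b) • I ∧ (v = 0 → b = 0) := by
  obtain ⟨f₀, f₁, hf⟩ := hf
  obtain ⟨-, h1, h2⟩ := hf u v fun K hK => add_smul_mem_sSpectrum T hI hK h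
  refine ⟨f₀ u v, f₁ u v, h2 I hI, ?_, ?_⟩
  -- Read `u - I v` as `u + (-I) v` and use the same coefficients with the imaginary unit `-I`.
  · rw [neg_smul, neg_smul, ← smul_neg, ← smul_neg]
    exact h2 _ (neg_mem_unitSphere hI)
  · rintro rfl
    rw [neg_zero] at h1
    linarith

theorem mem_slice (hf : IsIntrinsicOn f (sSpectrum T)) (hI : I ∈ unitSphere n) {p : Cl n}
    (hp : p ∈ sSpectrum T ∩ slice I) : f p ∈ slice I := by
  obtain ⟨h, u, v, rfl⟩ := hp
  obtain ⟨a, b, h1, -⟩ := hf.exists_eq hI h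
  exact ⟨a, b, h1⟩

theorem apply_sliceConj (hf : IsIntrinsicOn f (sSpectrum T)) (hI : I ∈ unitSphere n) {p : Cl n}
    (hp : p ∈ sSpectrum T ∩ slice I) : f (sliceConj I p) = sliceConj I (f p) := by
  obtain ⟨h, u, v, rfl⟩ := hp
  obtain ⟨a, b, h1, h2, -⟩ := hf.exists_eq hI h
  rw [sliceConj_add_smul hI, h1, h2, sliceConj_add_smul hI]

theorem inner_eq_zero (hf : IsIntrinsicOn f (sSpectrum T)) (hI : I ∈ unitSphere n) {p : Cl n}
    (hp : p ∈ sSpectrum T ∩ slice I) (h0 : inner ℝ I p = 0) : inner ℝ I (f p) = 0 := by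
  obtain ⟨h, u, v, rfl⟩ := hp
  obtain ⟨a, b, h1, -, h2⟩ := hf.exists_eq hI h
  rw [inner_add_smul hI] at h0
  rw [h1, inner_add_smul hI, h2 h0]

/-- Continuity of `f` is given only on the upper half, so the rest of the image is obtained by
conjugation. -/
theorem image_slice (hf : IsIntrinsicOn f (sSpectrum T)) (hI : I ∈ unitSphere n) :
    f '' (sSpectrum T ∩ slice I) = f '' (sSpectrum T ∩ upperSlice I) ∪
      sliceConj I '' (f '' (sSpectrum T ∩ upperSlice I)) := by
  ext w
  constructor
  · rintro ⟨p, hp, rfl⟩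
    rcases mem_upperSlice_or hI hp.2 with h | h
    · exact Or.inl ⟨p, ⟨hp.1, h⟩, rfl⟩
    · refine Or.inr ⟨_, ⟨_, ⟨(sliceConj_mem T hI hp).1, h⟩, rfl⟩, ?_⟩
      rw [hf.apply_sliceConj hI hp, sliceConj_sliceConj hI (hf.mem_slice hI hp)]
  · rintro (⟨p, hp, rfl⟩ | ⟨_, ⟨p, hp, rfl⟩, rfl⟩)
    · exact ⟨p, ⟨hp.1, mem_slice_of_mem_upperSlice hp.2⟩, rfl⟩
    · have hp' : p ∈ sSpectrum T ∩ slice I := ⟨hp.1, mem_slice_of_mem_upperSlice hp.2⟩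
      exact ⟨_, sliceConj_mem T hI hp', hf.apply_sliceConj hI hp'⟩

theorem id (T : CliffordModule H n →ₗ.[ℝ] CliffordModule H n) : IsIntrinsicOn (fun w : Cl n => w) (sSpectrum T) :=
  ⟨fun u _ => u, fun _ v => v, fun _ _ _ => ⟨rfl, rfl, fun _ _ => rfl⟩⟩

end IsIntrinsicOn

variable [CompleteSpace H]

/-- The symbol of `Q_s` splits into these two factors. An essential lower bound on it yields a
bounded, densely defined inverse (`quadOp_invertible`); conversely, a bounded inverse forces such a
bound (`exists_toFun_eq_zero`). -/
theorem mem_sSpectrum_iff {X : Type*} [MeasurableSpace X]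
    {E : ProjectionMeasure X (CliffordModule H n)}
    {J : CliffordModule H n →L[ℝ] CliffordModule H n} {N : Set X} {l : X → ℂ}
    {T : CliffordModule H n →ₗ.[ℝ] CliffordModule H n} (h : E.IsIntegralOf J N l T)
    (hI : I ∈ unitSphere n) {s : Cl n} (hs : s ∈ slice I) :
    s ∈ sSpectrum T ↔ ∀ c > 0, E.toFun {t | ‖(l t - sliceCoord I s) *
      (l t - (starRingEnd ℂ) (sliceCoord I s))‖ < c} ≠ 0 := by
  simp only [← quad_eq_mul hI hs]
  constructor
  · intro hs' c hc hE
    obtain ⟨h1, h2⟩ := h.quadOp_invertible hc hE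
    refine hs'.2 ⟨hs'.1, fun x hx => ?_, h2, _, h1⟩
    have h3 := h1 x
    rw [show quadOp T (s ∅) (‖s‖ ^ 2) x = 0 from hx, norm_zero, mul_zero] at h3
    exact norm_le_zero_iff.1 h3
  · intro h1
    refine ⟨slice_subset_paravectors hI hs, fun h2 => ?_⟩
    obtain ⟨-, -, -, C, hC⟩ := h2
    obtain ⟨c, hc, h3⟩ := h.exists_toFun_eq_zero (a := s ∅) (b := ‖s‖ ^ 2) hC
    exact h1 c hc h3

end Spectrum

/-! ### From Clifford-valued to real spectral measures -/

namespace SpectralMeasure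

variable {X : Type*} [MeasurableSpace X] {H : Type*} [NormedAddCommGroup H]
  [InnerProductSpace ℝ H] {n : ℕ}

/-- A spectral measure as a projection-valued measure on the real Hilbert space `H_n`. -/
def toProjectionMeasure (E : SpectralMeasure X H n) :
    ProjectionMeasure X (CliffordModule H n) where
  toFun := E.toFun
  inner_toFun_left := fun M hM x y => by
    rw [← cliffInner_apply_empty, ← cliffInner_apply_empty, E.selfAdjoint M hM]
  idempotent := E.idempotent
  univ_eq := E.univ_eq
  hasSum_iUnion := E.hasSum_iUnion

theorem integralJ_eq (E : SpectralMeasure X H n)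
    (J : CliffordModule H n →L[ℝ] CliffordModule H n) (I : Cl n) (f : X → Cl n) :
    E.integralJ J I f = E.toProjectionMeasure.complexIntegral J fun t => sliceCoord I (f t) := rfl

theorem scalarMeasure_apply (E : SpectralMeasure X H n) (x : CliffordModule H n) {M : Set X}
    (hM : MeasurableSet M) :
    E.scalarMeasure x M = ENNReal.ofReal (cliffInner (E.toFun M x) x ∅) :=
  Measure.ofMeasurable_apply M hM

/-- The scalar measure of `E(M) x` is finite and carried by `M`, where `f` is bounded. This puts the
ranges of the truncating projections into the domain of `T`. -/
theorem lintegral_toFun_lt_top (E : SpectralMeasure X H n) (x : CliffordModule H n) {M : Set X}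
    (hM : MeasurableSet M) (f : X → Cl n) (k : ℕ) (hf : ∀ t ∈ M, ‖f t‖ ≤ k) :
    ∫⁻ t, ‖f t‖ₑ ^ 2 ∂(E.scalarMeasure (E.toFun M x)) < ∞ := by
  have h0 : E.scalarMeasure (E.toFun M x) Mᶜ = 0 := by
    have h1 : E.toFun Mᶜ (E.toFun M x) = 0 := congrArg
      (fun S : CliffordModule H n →L[ℝ] CliffordModule H n => S x)
      (E.toProjectionMeasure.toFun_mul_of_disjoint hM.compl hM disjoint_compl_left)
    rw [E.scalarMeasure_apply _ hM.compl, h1, cliffInner_apply_empty, inner_zero_left,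
      ENNReal.ofReal_zero]
  have h1 : ∀ᵐ t ∂(E.scalarMeasure (E.toFun M x)), ‖f t‖ₑ ^ 2 ≤ (k : ℝ≥0∞) ^ 2 := by
    filter_upwards [measure_eq_zero_iff_ae_notMem.1 h0] with t ht
    have htM : t ∈ M := Set.notMem_compl_iff.1 ht
    have h2 : ‖f t‖ₑ ≤ (k : ℝ≥0∞) := by
      rw [← ofReal_norm, ← ENNReal.ofReal_natCast]
      exact ENNReal.ofReal_le_ofReal (hf t htM)
    exact pow_le_pow_left' h2 2
  refine (lintegral_mono_ae h1).trans_lt ?_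
  rw [lintegral_const, E.scalarMeasure_apply _ MeasurableSet.univ]
  exact ENNReal.mul_lt_top (by simp) ENNReal.ofReal_lt_top

end SpectralMeasure

/-! ### Full support, spectral mapping and compactness -/

namespace IsSpectralMeasureOf

variable {H : Type*} [NormedAddCommGroup H] [InnerProductSpace ℝ H] {n : ℕ}
  {T : CliffordModule H n →ₗ.[ℝ] CliffordModule H n} {I : Cl n}
  {E : SpectralMeasure ↥(sSpectrum T ∩ upperSlice I) H n}
  {J : CliffordModule H n →L[ℝ] CliffordModule H n}

theorem mem_spectrum_slice (t : ↥(sSpectrum T ∩ upperSlice I)) :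
    (t : Cl n) ∈ sSpectrum T ∩ slice I :=
  ⟨t.2.1, mem_slice_of_mem_upperSlice t.2.2⟩

theorem isComplexStructureOn (hE : IsSpectralMeasureOf T I E J) :
    E.toProjectionMeasure.IsComplexStructureOn J {t | 0 < (inner ℝ I (t : Cl n) : ℝ)} where
  measurableSet := measurableSet_lt measurable_const
    (Continuous.measurable (by fun_prop))
  commute := hE.2.1
  sq := hE.2.2.1

theorem inner_eq_zero_of_notMem (hI : I ∈ unitSphere n) {t : ↥(sSpectrum T ∩ upperSlice I)}
    (ht : t ∉ {t : ↥(sSpectrum T ∩ upperSlice I) | 0 < (inner ℝ I (t : Cl n) : ℝ)}) :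
    inner ℝ I (t : Cl n) = 0 :=
  le_antisymm (not_lt.1 ht) ((mem_upperSlice_iff hI).1 t.2.2).2

theorem isIntegralOf (hE : IsSpectralMeasureOf T I E J) (hI : I ∈ unitSphere n) :
    E.toProjectionMeasure.IsIntegralOf J {t | 0 < (inner ℝ I (t : Cl n) : ℝ)}
      (fun t => sliceCoord I t) T := by
  have hset : ∀ k : ℕ, {t : ↥(sSpectrum T ∩ upperSlice I) | ‖sliceCoord I t‖ ≤ k} =
      {t : ↥(sSpectrum T ∩ upperSlice I) | ‖(t : Cl n)‖ ≤ k} := fun k => by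
    simp only [norm_sliceCoord hI (mem_spectrum_slice _).2]
  refine ⟨hE.isComplexStructureOn, ?_, fun t ht => inner_eq_zero_of_notMem hI ht,
    fun k x => ?_, fun x => ?_⟩
  · exact ((continuous_sliceCoord I).comp continuous_subtype_val).measurable
  · rw [hset, ← SetLike.mem_coe, hE.2.2.2.1]
    exact E.lintegral_toFun_lt_top x
      (measurableSet_le (Continuous.measurable (by fun_prop)) measurable_const) _ k
      fun t ht => ht
  · refine (hE.2.2.2.2 x).congr fun k => ?_
    rw [E.integralJ_eq, hset]
    congr 2
    ext t
    by_cases ht : ‖(t : Cl n)‖ ≤ k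
    · simp [ht]
    · simp [ht, sliceCoord]
      rfl

variable [CompleteSpace H]

/-- The support of the spectral measure is the whole spectrum. -/
theorem toFun_ne_zero (hE : IsSpectralMeasureOf T I E J) (hI : I ∈ unitSphere n)
    {U : Set ↥(sSpectrum T ∩ upperSlice I)} (hU : IsOpen U) (hne : U.Nonempty) :
    E.toFun U ≠ 0 := by
  obtain ⟨s, hs⟩ := hne
  obtain ⟨ε, hε, hεU⟩ := Metric.isOpen_iff.1 hU s hs
  intro h0
  have h := hE.isIntegralOf hI
  refine (mem_sSpectrum_iff h hI (mem_spectrum_slice s).2).1 s.2.1 (ε ^ 2) (by positivity) ?_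
  have hl := h.measurable
  set q : ↥(sSpectrum T ∩ upperSlice I) → ℂ := fun t => (sliceCoord I t - sliceCoord I s) *
    (sliceCoord I t - (starRingEnd ℂ) (sliceCoord I s)) with hq
  have hqm : Measurable q := (hl.sub measurable_const).mul (hl.sub measurable_const)
  -- Both `t` and `s` lie in the upper half plane, so `|t - s|² ≤ |t - s| |t - s̄| = |q t| < ε²`.
  have hsub : {t | ‖q t‖ < ε ^ 2} ⊆ U := fun t ht => by
    refine hεU ?_
    rw [Metric.mem_ball, Subtype.dist_eq, dist_eq_norm,
      ← norm_sliceCoord_sub hI (mem_spectrum_slice t).2 (mem_spectrum_slice s).2]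
    have h1 := norm_sub_le_norm_sub_conj (z := sliceCoord I t) (w := sliceCoord I s)
      ((mem_upperSlice_iff hI).1 t.2.2).2 ((mem_upperSlice_iff hI).1 s.2.2).2
    have h2 : ‖q t‖ < ε ^ 2 := ht
    rw [hq, norm_mul] at h2
    refine lt_of_pow_lt_pow_left₀ 2 hε.le (lt_of_le_of_lt ?_ h2)
    rw [pow_two]
    exact mul_le_mul_of_nonneg_left h1 (norm_nonneg _)
  have h1 := E.toProjectionMeasure.toFun_inter (measurableSet_lt hqm.norm measurable_const)
    hU.measurableSet (M := {t | ‖q t‖ < ε ^ 2})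
  rw [Set.inter_eq_left.2 hsub, show E.toProjectionMeasure.toFun U = 0 from h0, mul_zero] at h1
  exact h1

/-- The spectral mapping theorem for an operator given by a spectral integral. -/
theorem sSpectrum_inter_slice (hE : IsSpectralMeasureOf T I E J) (hI : I ∈ unitSphere n)
    {f : Cl n → Cl n} (hf : IsIntrinsicOn f (sSpectrum T))
    (hcont : ContinuousOn f (sSpectrum T ∩ upperSlice I))
    {S : CliffordModule H n →ₗ.[ℝ] CliffordModule H n}
    (hS : E.toProjectionMeasure.IsIntegralOf J {t | 0 < (inner ℝ I (t : Cl n) : ℝ)}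
      (fun t => sliceCoord I (f t)) S) :
    sSpectrum S ∩ slice I = closure (f '' (sSpectrum T ∩ slice I)) := by
  have hFc : Continuous fun t : ↥(sSpectrum T ∩ upperSlice I) => sliceCoord I (f t) :=
    (continuous_sliceCoord I).comp hcont.domRestrict
  -- Distances in the Clifford algebra agree with those of the complex coordinates only inside the
  -- plane, so limit points must be kept there.
  have hslice : closure (f '' (sSpectrum T ∩ slice I)) ⊆ slice I := by
    have hclosed : IsClosed (slice I) := by
      have : slice I = (Submodule.span ℝ {1, I} : Submodule ℝ (Cl n)) := by
        ext w
        rw [SetLike.mem_coe, Submodule.mem_span_pair]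
        exact ⟨fun ⟨u, v, h⟩ => ⟨u, v, h.symm⟩, fun ⟨u, v, h⟩ => ⟨u, v, h.symm⟩⟩
      rw [this]
      exact Submodule.closed_of_finiteDimensional _
    refine closure_minimal ?_ hclosed
    rintro _ ⟨p, hp, rfl⟩
    exact hf.mem_slice hI hp
  ext s
  refine ⟨fun ⟨hs, hsI⟩ => ?_, fun hs => ⟨?_, hslice hs⟩⟩
  · by_contra hcl
    rw [Metric.mem_closure_iff] at hcl
    push Not at hcl
    obtain ⟨δ, hδ, hcl⟩ := hcl
    have hdist : ∀ p ∈ sSpectrum T ∩ slice I, δ ≤ ‖sliceCoord I (f p) - sliceCoord I s‖ :=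
      fun p hp => by
        rw [norm_sliceCoord_sub hI (hf.mem_slice hI hp) hsI, ← dist_eq_norm, dist_comm]
        exact hcl _ ⟨p, hp, rfl⟩
    refine (mem_sSpectrum_iff hS hI hsI).1 hs (δ ^ 2) (by positivity) ?_
    refine (congrArg E.toProjectionMeasure.toFun (Set.eq_empty_of_forall_notMem
      fun t ht => ?_)).trans E.toProjectionMeasure.toFun_empty_eq
    · have h1 := hdist t (mem_spectrum_slice t)
      -- The conjugate point also has its value at distance at least `δ` from `s`, which bounds the
      -- factor `f - s̄` from below. Hence the symbol is at least `δ²` everywhere.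
      have h2 := hdist _ (sliceConj_mem T hI (mem_spectrum_slice t))
      rw [hf.apply_sliceConj hI (mem_spectrum_slice t), sliceCoord_sliceConj hI,
        ← Complex.norm_conj, map_sub, Complex.conj_conj] at h2
      have h3 : ‖(sliceCoord I (f t) - sliceCoord I s) *
        (sliceCoord I (f t) - (starRingEnd ℂ) (sliceCoord I s))‖ < δ ^ 2 := ht
      rw [norm_mul] at h3
      nlinarith
  · have hsI := hslice hs
    refine (mem_sSpectrum_iff hS hI hsI).2 fun c hc => ?_
    -- By full support it is enough to find one point of the upper half where the symbol is smaller
    -- than `c`.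
    refine hE.toFun_ne_zero hI (isOpen_lt (by fun_prop) continuous_const) ?_
    set w := sliceCoord I s
    -- When `f p` is within `1` of `w`, the factor `f p - w̄` is at most `1 + 2 ‖w‖`, so the
    -- distance `c / (1 + 2 ‖w‖)` makes the product small.
    have hpos : 0 < 1 + 2 * ‖w‖ := by positivity
    obtain ⟨_, ⟨p, hp, rfl⟩, hps⟩ := Metric.mem_closure_iff.1 hs (min 1 (c / (1 + 2 * ‖w‖)))
      (by positivity)
    rw [dist_comm, dist_eq_norm, ← norm_sliceCoord_sub hI (hf.mem_slice hI hp) hsI] at hps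
    have hsmall : ‖(sliceCoord I (f p) - w) * (sliceCoord I (f p) - (starRingEnd ℂ) w)‖ < c := by
      have h1 : ‖sliceCoord I (f p) - (starRingEnd ℂ) w‖ ≤ 1 + 2 * ‖w‖ := by
        calc ‖sliceCoord I (f p) - (starRingEnd ℂ) w‖
            = ‖(sliceCoord I (f p) - w) + (w - (starRingEnd ℂ) w)‖ := by congr 1; ring
          _ ≤ ‖sliceCoord I (f p) - w‖ + (‖w‖ + ‖(starRingEnd ℂ) w‖) :=
            (norm_add_le _ _).trans (by gcongr; exact norm_sub_le _ _)
          _ ≤ 1 + 2 * ‖w‖ := by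
            rw [Complex.norm_conj]
            linarith [hps.trans_le (min_le_left _ _)]
      rw [norm_mul]
      calc ‖sliceCoord I (f p) - w‖ * ‖sliceCoord I (f p) - (starRingEnd ℂ) w‖
          ≤ ‖sliceCoord I (f p) - w‖ * (1 + 2 * ‖w‖) := by gcongr
        _ < c / (1 + 2 * ‖w‖) * (1 + 2 * ‖w‖) := by
          gcongr
          exact hps.trans_le (min_le_right _ _)
        _ = c := div_mul_cancel₀ _ hpos.ne'
    rcases mem_upperSlice_or hI hp.2 with h | h
    · exact ⟨⟨p, hp.1, h⟩, hsmall⟩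
    -- If `p` is in the lower half, its conjugate serves: conjugation swaps the two factors up to
    -- conjugates.
    · refine ⟨⟨_, (sliceConj_mem T hI hp).1, h⟩, ?_⟩
      change ‖(sliceCoord I (f (sliceConj I p)) - w) *
        (sliceCoord I (f (sliceConj I p)) - (starRingEnd ℂ) w)‖ < c
      rw [hf.apply_sliceConj hI hp, sliceCoord_sliceConj hI, ← Complex.norm_conj]
      simpa [mul_comm] using hsmall

/-- The spectral mapping statement for the identity function, with `T` itself as the integral,
exhibits this set as a closure. -/
theorem isClosed_sSpectrum_inter_slice (hE : IsSpectralMeasureOf T I E J)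
    (hI : I ∈ unitSphere n) : IsClosed (sSpectrum T ∩ slice I) := by
  have h := hE.sSpectrum_inter_slice hI (IsIntrinsicOn.id T) continuousOn_id
    (hE.isIntegralOf hI)
  rw [h]
  exact isClosed_closure

/-- Boundedness of `T` bounds `λ` off a set of `E`-measure zero; that set is relatively open, so by
full support it is empty. -/
theorem isCompact_sSpectrum_inter_upperSlice (hE : IsSpectralMeasureOf T I E J)
    (hI : I ∈ unitSphere n) (hT : IsBounded T) : IsCompact (sSpectrum T ∩ upperSlice I) := by
  refine Metric.isCompact_of_isClosed_isBounded ?_ ?_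
  · have : sSpectrum T ∩ upperSlice I = (sSpectrum T ∩ slice I) ∩ {w | 0 ≤ inner ℝ I w} := by
      ext w
      simp only [Set.mem_inter_iff, mem_upperSlice_iff hI, Set.mem_ofPred_eq, and_assoc]
    rw [this]
    exact (hE.isClosed_sSpectrum_inter_slice hI).inter
      (isClosed_le continuous_const (by fun_prop))
  · obtain ⟨-, C, hC⟩ := hT
    obtain ⟨R, hR⟩ := (hE.isIntegralOf hI).exists_toFun_norm_eq_zero hC
    refine (isBounded_iff_forall_norm_le (s := sSpectrum T ∩ upperSlice I)).2 ⟨R, fun w hw => ?_⟩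
    by_contra hwR
    refine hE.toFun_ne_zero hI (U := {t | R < ‖sliceCoord I t‖}) ?_ ⟨⟨w, hw⟩, ?_⟩ hR
    · exact isOpen_lt continuous_const
        ((continuous_sliceCoord I).comp continuous_subtype_val).norm
    · change R < ‖sliceCoord I w‖
      rw [norm_sliceCoord hI (mem_slice_of_mem_upperSlice hw.2)]
      exact not_le.1 hwR

end IsSpectralMeasureOf

end Clif

theorem mainTheorem9 {H : Type*} [NormedAddCommGroup H] [InnerProductSpace ℝ H] [CompleteSpace H]
    {n : ℕ} (hn : 0 < n) {I : Clif.Cl n} (hI : I ∈ Clif.unitSphere n)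
    (T : Clif.CliffordModule H n →ₗ.[ℝ] Clif.CliffordModule H n)
    (hlin : Clif.IsRightLinear T) (hT : Clif.IsNormal T)
    (E : Clif.SpectralMeasure ↥(Clif.sSpectrum T ∩ Clif.upperSlice I) H n)
    (J : Clif.CliffordModule H n →L[ℝ] Clif.CliffordModule H n)
    (hE : Clif.IsSpectralMeasureOf T I E J)
    (f : Clif.Cl n → Clif.Cl n) (hf : Clif.IsIntrinsicOn f (Clif.sSpectrum T))
    (hcont : ContinuousOn f (Clif.sSpectrum T ∩ Clif.upperSlice I))
    (hbdd : ∃ C : ℝ, ∀ t ∈ Clif.sSpectrum T ∩ Clif.upperSlice I, ‖f t‖ ≤ C) :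
    Clif.sSpectrum (Clif.toOp (E.integralJ J I fun t => f t)) ∩ Clif.slice I =
        closure (f '' (Clif.sSpectrum T ∩ Clif.slice I)) ∧
      (Clif.IsBounded T →
        Clif.sSpectrum (Clif.toOp (E.integralJ J I fun t => f t)) ∩ Clif.slice I =
          f '' (Clif.sSpectrum T ∩ Clif.slice I)) := by
  have hadm : Clif.IsAdmissible
      {t : ↥(Clif.sSpectrum T ∩ Clif.upperSlice I) | 0 < (inner ℝ I (t : Clif.Cl n) : ℝ)}
      fun t => Clif.sliceCoord I (f t) := by
    obtain ⟨C, hC⟩ := hbdd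
    refine ⟨((Clif.continuous_sliceCoord I).comp hcont.domRestrict).measurable, ⟨C, fun t => ?_⟩,
      fun t ht => ?_⟩
    · rw [Clif.norm_sliceCoord hI
        (hf.mem_slice hI (Clif.IsSpectralMeasureOf.mem_spectrum_slice t))]
      exact hC t t.2
    · exact hf.inner_eq_zero hI (Clif.IsSpectralMeasureOf.mem_spectrum_slice t)
        (Clif.IsSpectralMeasureOf.inner_eq_zero_of_notMem hI ht)
  have hmain : Clif.sSpectrum (Clif.toOp (E.integralJ J I fun t => f t)) ∩ Clif.slice I =
      closure (f '' (Clif.sSpectrum T ∩ Clif.slice I)) :=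
    hE.sSpectrum_inter_slice hI hf hcont
      (Clif.ProjectionMeasure.isIntegralOf_complexIntegral hE.isComplexStructureOn hadm)
  refine ⟨hmain, fun hb => ?_⟩
  -- The image of the upper half is compact, and the image of the full slice is its union with its
  -- conjugate, hence closed already.
  have hK := (hE.isCompact_sSpectrum_inter_upperSlice hI hb).image_of_continuousOn hcont
  rw [hmain, hf.image_slice hI]
  exact (hK.union (hK.image (Clif.continuous_sliceConj I))).isClosed.closure_eq
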